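/- **Setting.** Let $n\ge 3$, $T>0$, $\rho_*>0$, let $\mathcal S$ be a smooth $(n-1)$-dimensional manifold, and put $\mathcal I=(0,\pi T)\times\mathcal S$, $\mathcal M=(0,\rho_*)\times\mathcal I$, with coordinates $\rho$ and $t$ on the first two factors. Coordinates $\varphi=(x^A)$ on $\mathcal S$ are extended to coordinates $(\rho,t,x^A)$ on $\mathcal M$. A smooth function $u$ is $\mathcal O_\varphi(1)$ if for all $k,m\ge0$ and all coordinates $x^{a_i}\in\{t,x^A\}$ one has $|\partial_\rho^k\partial_{x^{a_1}}\cdots\partial_{x^{a_m}}u|\lesssim\rho^{-k}$. Let $(\mathcal M,g)$ be an admissible Fefferman–Graham-aAdS segment: $g$ is a smooth Lorentzian metric with $$g=\rho^{-2}\left(d\rho^2+\mathring{\mathfrak g}+\rho^2\,\bar{\mathfrak g}+\rho^3\,\mathfrak r\right),\qquad \mathring{\mathfrak g}=-dt^2+\gamma,$$ where $\gamma$ is a (possibly $t$-dependent) Riemannian metric on $\mathcal S$, $\bar{\mathfrak g}$ is a smooth symmetric $2$-tensor on $\mathcal I$, $\mathfrak r$ is a smooth symmetric $2$-tensor on $\mathcal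 M$ with components only tangent to the level sets of $\rho$, and there is a finite family $\Xi$ of coordinate systems covering $\mathcal S$ such that for each $\varphi\in\Xi$ the components of $\mathring{\mathfrak g}$, $\mathring{\mathfrak g}^{-1}$, $\bar{\mathfrak g}$ and $\mathfrak r$ are $\mathcal O_\varphi(1)$. The *pseudoconvexity property* holds if there are $K>0$, $\xi\ge0$ and $\zeta\in C^\infty(\mathcal M)$ such that $\zeta=\mathcal O_\varphi(1)$ for each $\varphi\in\Xi$; $|\mathcal L_{\partial_t}\mathring{\mathfrak g}(Y,Y)|\le\xi\,\mathring{\mathfrak g}(Y,Y)$ for all $Y$ tangent to $\mathcal S$; and for all $X=X^t\partial_t+X^A\partial_A$ (and at all values of $\rho$) $$\Big[-\bar{\mathfrak g}-\Big(\mu^2+\tfrac{\xi^2}{16}\Big)dt^2-\zeta\,\mathring{\mathfrak g}\Big](X,X)\ \ge\ K\left[(X^t)^2+\gamma_{AB}X^AX^B\right],$$ where $\mu$ is the unique number with $\frac1T\le\mu<\frac2T$ and $T=\frac2\mu-\frac{2}{\mu\pi}\arctan\frac{4\mu}{\xi}$ (for $\xi=0$ the arctangent is read as $\frac\pi2$,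 so $\mu=\frac1T$). **Proposition.** Suppose that $(\mathcal M,g)$ satisfies the Einstein-vacuum equations $\operatorname{Ric}[g]=-n\,g$ and that the boundary is static, i.e. $\mathring{\mathfrak g}=-dt^2+\gamma$ with $\gamma$ independent of $t$. Let $\mathcal Ric$ and $\mathcal R$ be the Ricci and scalar curvatures of $(\mathcal S,\gamma)$. 1. Suppose $\mathcal Ric\ge(n-2)\,C^2\,\gamma$ on $\mathcal S$ for some constant $C>0$. Then * for every $c\in(0,C)$ the symmetric tensor $$-\bar{\mathfrak g}-c^2dt^2+\left[\frac{\mathcal R}{2(n-1)(n-2)}-\frac12\left(C^2+c^2\right)\right]\mathring{\mathfrak g}$$ is uniformly positive definite on $\mathcal I$, i.e. there is $K>0$ such that its value at $(X,X)$ is at least $K[(X^t)^2+\gamma_{AB}X^AX^B]$ for every tangent vector $X$ of $\mathcal I$; * if $T>C^{-1}$, then the pseudoconvexity property holds. 2. If $\mathcal Ric\le0$ (as a quadratic form) at some point of $\mathcal S$, then the pseudoconvexity property fails. -/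

import Mathlib

open scoped Manifold ContDiff

noncomputable section

namespace FGaAdS

/-! ### Curvature of a pseudo-Riemannian metric in coordinates

`V` is a coordinate space, `e : ι → V` its coordinate directions, and `G : V → Matrix ι ι ℝ` the
matrix of components of a metric, as a function of the coordinates. -/

section Coordinates

variable {V : Type*} [NormedAddCommGroup V] [NormedSpace ℝ V] {ι : Type*}

/-- The partial derivative `∂_v F` in the direction `v`. -/
def partialDeriv (v : V) (F : V → ℝ) (y : V) : ℝ := fderiv ℝ F y v

/-- The iterated partial derivative `∂_{v₁} ⋯ ∂_{v_m} F`. -/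
def iterPartial : List V → (V → ℝ) → V → ℝ
  | [], F => F
  | v :: l, F => partialDeriv v (iterPartial l F)

variable [Fintype ι] [DecidableEq ι] (e : ι → V) (G : V → Matrix ι ι ℝ)

/-- The Christoffel symbols
`Γ^k_{ij} = ½ G^{kl} (∂_i G_{jl} + ∂_j G_{il} - ∂_l G_{ij})`. -/
def christoffel (k i j : ι) (y : V) : ℝ :=
  (1 / 2) * ∑ l, (G y)⁻¹ k l *
    (partialDeriv (e i) (fun z => G z j l) y + partialDeriv (e j) (fun z => G z i l) y
      - partialDeriv (e l) (fun z => G z i j) y)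

/-- The components of the Ricci curvature,
`Ric_{ij} = ∂_k Γ^k_{ij} - ∂_j Γ^k_{ik} + Γ^k_{kl} Γ^l_{ij} - Γ^k_{jl} Γ^l_{ik}`
(positive on round spheres). -/
def ricciCoord (i j : ι) (y : V) : ℝ :=
  ∑ k, (partialDeriv (e k) (christoffel e G k i j) y
      - partialDeriv (e j) (christoffel e G k i k) y
      + ∑ l, (christoffel e G k k l y * christoffel e G l i j y
          - christoffel e G k j l y * christoffel e G l i k y))

end Coordinates

/-! ### Points, tangent vectors, coordinates

`S` is the `(n-1)`-dimensional boundary cross-section, `I = (0, πT) × S`,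
`M = (0, ρ⋆) × (0, πT) × S`.  Tangent vectors of `I` at `(t, x)` are pairs
`(X^t, v) ∈ ℝ × T_x S`; tangent vectors of `M` at `(ρ, t, x)` are triples
`(X^ρ, X^t, v) ∈ ℝ × ℝ × T_x S`. -/

/-- The model space of `S`. -/
abbrev E (n : ℕ) : Type := EuclideanSpace ℝ (Fin (n - 1))

/-- The space of coordinate values `(ρ, t, x^1, …, x^{n-1})`. -/
abbrev Coords (n : ℕ) : Type := ℝ × ℝ × E n

/-- Indices of the coordinates `(t, x^A)`; `none` is the index of `t`. -/
abbrev IdxI (n : ℕ) : Type := Option (Fin (n - 1))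

/-- Indices of the coordinates `(ρ, t, x^A)`; `none` is the index of `ρ`, `some none` that
of `t`. -/
abbrev IdxM (n : ℕ) : Type := Option (IdxI n)

/-- The coordinate directions of `(x^A)`. -/
def dirS (n : ℕ) (A : Fin (n - 1)) : E n := EuclideanSpace.single A 1

/-- The coordinate directions of `(ρ, t, x^A)`. -/
def dirM (n : ℕ) : IdxM n → Coords n
  | none => (1, 0, 0)
  | some none => (0, 1, 0)
  | some (some A) => (0, 0, dirS n A)

section Slice

variable {n : ℕ} {S : Type*} [TopologicalSpace S] [ChartedSpace (E n) S]

/-- The tangent space of `S` at `x`. -/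
abbrev TS (n : ℕ) {S : Type*} [TopologicalSpace S] [ChartedSpace (E n) S] (x : S) : Type :=
  TangentSpace 𝓘(ℝ, E n) x

/-- The coordinate systems on `S`: the smooth charts. -/
abbrev charts (n : ℕ) (S : Type*) [TopologicalSpace S] [ChartedSpace (E n) S] :
    Set (OpenPartialHomeomorph S (E n)) :=
  IsManifold.maximalAtlas 𝓘(ℝ, E n) ∞ S

/-- The coordinate vector field `∂_{x^A}` of the coordinate system `φ` at the point with
coordinates `z`. -/
def frameS (φ : OpenPartialHomeomorph S (E n)) (z : E n) (A : Fin (n - 1)) : TS n (φ.symm z) :=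
  mfderiv 𝓘(ℝ, E n) 𝓘(ℝ, E n) φ.symm z (dirS n A)

/-- The coordinate vector fields `∂_t, ∂_{x^A}` on `I`. -/
def frameI (φ : OpenPartialHomeomorph S (E n)) (z : E n) : IdxI n → ℝ × TS n (φ.symm z)
  | none => (1, 0)
  | some A => (0, frameS φ z A)

/-- The coordinate vector fields `∂_ρ, ∂_t, ∂_{x^A}` on `M`. -/
def frameM (φ : OpenPartialHomeomorph S (E n)) (z : E n) : IdxM n → ℝ × ℝ × TS n (φ.symm z)
  | none => (1, 0, 0)
  | some a => (0, frameI φ z a)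

/-- The components `v^A = dx^A(v)` of `v ∈ T_x S` in the coordinate system `φ`. -/
def compS (φ : OpenPartialHomeomorph S (E n)) (x : S) (v : TS n x) (A : Fin (n - 1)) : ℝ :=
  EuclideanSpace.proj (𝕜 := ℝ) A (mfderiv 𝓘(ℝ, E n) 𝓘(ℝ, E n) φ x v : E n)

/-- The components of a tangent vector of `M` at a point `(ρ, t, x)`. -/
def compM (φ : OpenPartialHomeomorph S (E n)) (x : S) (X : ℝ × ℝ × TS n x) : IdxM n → ℝ
  | none => X.1
  | some none => X.2.1
  | some (some A) => compS φ x X.2.2 A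

/-- Covariant `2`-tensors on `S`. -/
abbrev TensorS (n : ℕ) (S : Type*) [TopologicalSpace S] [ChartedSpace (E n) S] : Type _ :=
  (x : S) → LinearMap.BilinForm ℝ (TS n x)

/-- The component matrix `γ_{AB}` of a `2`-tensor on `S`. -/
def compTensorS (φ : OpenPartialHomeomorph S (E n)) (γ : TensorS n S) (z : E n) :
    Matrix (Fin (n - 1)) (Fin (n - 1)) ℝ :=
  Matrix.of fun A B => γ (φ.symm z) (frameS φ z A) (frameS φ z B)

/-- The Ricci tensor `Ric_x(v, w)` of a metric `γ` on `S`, computed in the preferred chart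
at `x`. -/
def ricciS (γ : TensorS n S) (x : S) (v w : TS n x) : ℝ :=
  let φ := chartAt (E n) x
  ∑ A, ∑ B, ricciCoord (dirS n) (compTensorS φ γ) A B (φ x) * compS φ x v A * compS φ x w B

/-- The scalar curvature of a metric `γ` on `S`. -/
def scalarS (γ : TensorS n S) (x : S) : ℝ :=
  let φ := chartAt (E n) x
  ∑ A, ∑ B, (compTensorS φ γ (φ x))⁻¹ A B *
    ricciCoord (dirS n) (compTensorS φ γ) A B (φ x)

end Slice

section Spacetime

variable {n : ℕ} {S : Type*} [TopologicalSpace S] [ChartedSpace (E n) S]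

/-- Covariant `2`-tensors on `M`; only their values at `0 < ρ < ρ⋆`, `0 < t < πT` matter. -/
abbrev TensorM (n : ℕ) (S : Type*) [TopologicalSpace S] [ChartedSpace (E n) S] : Type _ :=
  (_ρ _t : ℝ) → (x : S) → LinearMap.BilinForm ℝ (ℝ × ℝ × TS n x)

/-- Covariant `2`-tensors on `M` that only have components tangent to the level sets
of `ρ`. -/
abbrev HTensorM (n : ℕ) (S : Type*) [TopologicalSpace S] [ChartedSpace (E n) S] : Type _ :=
  (_ρ _t : ℝ) → (x : S) → LinearMap.BilinForm ℝ (ℝ × TS n x)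

/-- Covariant `2`-tensors on `I`; only their values at `0 < t < πT` matter. -/
abbrev TensorI (n : ℕ) (S : Type*) [TopologicalSpace S] [ChartedSpace (E n) S] : Type _ :=
  (_t : ℝ) → (x : S) → LinearMap.BilinForm ℝ (ℝ × TS n x)

/-- The component matrix of a `2`-tensor on `M`, as a function of the coordinates
`(ρ, t, x^A)`. -/
def compTensorM (φ : OpenPartialHomeomorph S (E n)) (h : TensorM n S) (y : Coords n) :
    Matrix (IdxM n) (IdxM n) ℝ :=
  Matrix.of fun α β => h y.1 y.2.1 (φ.symm y.2.2) (frameM φ y.2.2 α) (frameM φ y.2.2 β)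

/-- The component matrix of a `2`-tensor on `M` tangent to the level sets of `ρ`, as a function
of the coordinates `(ρ, t, x^A)`. -/
def compHTensorM (φ : OpenPartialHomeomorph S (E n)) (h : HTensorM n S) (y : Coords n) :
    Matrix (IdxI n) (IdxI n) ℝ :=
  Matrix.of fun a b => h y.1 y.2.1 (φ.symm y.2.2) (frameI φ y.2.2 a) (frameI φ y.2.2 b)

/-- The component matrix of a `2`-tensor on `I`, as a (`ρ`-independent) function of the
coordinates `(ρ, t, x^A)`. -/
def compTensorI (φ : OpenPartialHomeomorph S (E n)) (h : TensorI n S) (y : Coords n) :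
    Matrix (IdxI n) (IdxI n) ℝ :=
  compHTensorM φ (fun _ => h) y

/-- The Ricci tensor `Ric_p(X, Y)` of a metric `g` on `M` at `p = (ρ, t, x)`, computed in the
coordinates `(ρ, t, x^A)` given by the preferred chart of `S` at `x`. -/
def ricciM (g : TensorM n S) (ρ t : ℝ) (x : S) (X Y : ℝ × ℝ × TS n x) : ℝ :=
  let φ := chartAt (E n) x
  ∑ α, ∑ β, ricciCoord (dirM n) (compTensorM φ g) α β (ρ, t, φ x) *
    compM φ x X α * compM φ x Y β

/-- The region of coordinate values `(ρ, t, x^A)` of the coordinate system of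
`M = (0, ρ⋆) × (0, πT) × S` transported from `φ`. -/
def coordDomain (ρs T : ℝ) (φ : OpenPartialHomeomorph S (E n)) : Set (Coords n) :=
  Set.Ioo 0 ρs ×ˢ Set.Ioo 0 (Real.pi * T) ×ˢ φ.target

/-- `u = O_φ(1)`: `u` is smooth, and for all `k` and all lists of indices `a₁, …, a_m` other
than `ρ` one has `|∂_ρ^k ∂_{a₁} ⋯ ∂_{a_m} u| ≲ ρ^{-k}`. -/
def IsBigOOne (ρs T : ℝ) (φ : OpenPartialHomeomorph S (E n)) (u : Coords n → ℝ) : Prop :=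
  ContDiffOn ℝ ∞ u (coordDomain ρs T φ) ∧
  ∀ (k : ℕ) (l : List (IdxI n)), ∃ K : ℝ, ∀ y ∈ coordDomain ρs T φ,
    |iterPartial (List.replicate k (dirM n none) ++ l.map fun a => dirM n (some a)) u y|
      ≤ K * (y.1 ^ k)⁻¹

/-- Symmetric bilinear forms of Lorentzian signature `(-, +, …, +)`. -/
def IsLorentzian {W : Type*} [AddCommGroup W] [Module ℝ W] (b : LinearMap.BilinForm ℝ W) :
    Prop :=
  (∀ X Y, b X Y = b Y X) ∧ ∃ U, b U U < 0 ∧ ∀ X, b U X = 0 → X ≠ 0 → 0 < b X X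

/-- `dt²` on `I`. -/
def dtSq (x : S) : LinearMap.BilinForm ℝ (ℝ × TS n x) :=
  (LinearMap.mul ℝ ℝ).compl₁₂ (LinearMap.fst ℝ ℝ (TS n x)) (LinearMap.fst ℝ ℝ (TS n x))

/-- `-dt² + γ` on `I`, for a `2`-tensor `γ` on `S` depending on `t`. -/
def boundaryMetric (γ : ℝ → TensorS n S) : TensorI n S := fun t x =>
  (γ t x).compl₁₂ (LinearMap.snd ℝ ℝ (TS n x)) (LinearMap.snd ℝ ℝ (TS n x)) - dtSq x

end Spacetime

/-- Admissible Fefferman-Graham asymptotically AdS segments `(M, g)` of dimension `n + 1`, with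
`M = (0, ρ⋆) × I` and `I = (0, πT) × S`, together with the coefficients
`gm = -dt² + γ`, `gs`, `r` of the expansion `g = ρ⁻² (dρ² + gm + ρ² gs + ρ³ r)`
and a bounded family `Ξ` of coordinates. -/
structure Segment (n : ℕ) (S : Type*) [TopologicalSpace S] [ChartedSpace (E n) S] (T : ℝ) where
  /-- the range of `ρ` -/
  ρs : ℝ
  ρs_pos : 0 < ρs
  T_pos : 0 < T
  /-- the spacetime metric: smooth and Lorentzian -/
  g : TensorM n S
  g_lorentzian : ∀ ρ ∈ Set.Ioo 0 ρs, ∀ t ∈ Set.Ioo 0 (Real.pi * T), ∀ x, IsLorentzian (g ρ t x)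
  g_smooth : ∀ φ ∈ charts n S, ∀ α β,
    ContDiffOn ℝ ∞ (fun y => compTensorM φ g y α β) (coordDomain ρs T φ)
  /-- the induced metrics on the level sets of `t` in `I` -/
  γ : ℝ → TensorS n S
  γ_symm : ∀ t ∈ Set.Ioo 0 (Real.pi * T), ∀ x v w, γ t x v w = γ t x w v
  γ_pos : ∀ t ∈ Set.Ioo 0 (Real.pi * T), ∀ x v, v ≠ 0 → 0 < γ t x v v
  /-- the second coefficient of the expansion -/
  gs : TensorI n S
  gs_symm : ∀ t ∈ Set.Ioo 0 (Real.pi * T), ∀ x X Y, gs t x X Y = gs t x Y X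
  /-- the remainder of the expansion -/
  r : HTensorM n S
  r_symm : ∀ ρ ∈ Set.Ioo 0 ρs, ∀ t ∈ Set.Ioo 0 (Real.pi * T), ∀ x X Y, r ρ t x X Y = r ρ t x Y X
  gm_smooth : ∀ φ ∈ charts n S, ∀ a b,
    ContDiffOn ℝ ∞ (fun y => compTensorI φ (boundaryMetric γ) y a b) (coordDomain ρs T φ)
  gs_smooth : ∀ φ ∈ charts n S, ∀ a b,
    ContDiffOn ℝ ∞ (fun y => compTensorI φ gs y a b) (coordDomain ρs T φ)
  r_smooth : ∀ φ ∈ charts n S, ∀ a b,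
    ContDiffOn ℝ ∞ (fun y => compHTensorM φ r y a b) (coordDomain ρs T φ)
  expansion : ∀ ρ ∈ Set.Ioo 0 ρs, ∀ t ∈ Set.Ioo 0 (Real.pi * T), ∀ (x : S)
    (X Y : ℝ × ℝ × TS n x), g ρ t x X Y = (ρ ^ 2)⁻¹ *
      (X.1 * Y.1 + boundaryMetric γ t x X.2 Y.2 + ρ ^ 2 * gs t x X.2 Y.2
        + ρ ^ 3 * r ρ t x X.2 Y.2)
  /-- a bounded family of coordinates -/
  Ξ : Set (OpenPartialHomeomorph S (E n))
  Ξ_finite : Ξ.Finite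
  Ξ_charts : Ξ ⊆ charts n S
  Ξ_covers : ∀ x, ∃ φ ∈ Ξ, x ∈ φ.source
  gm_bounded : ∀ φ ∈ Ξ, ∀ a b,
    IsBigOOne ρs T φ fun y => compTensorI φ (boundaryMetric γ) y a b
  gm_inv_bounded : ∀ φ ∈ Ξ, ∀ a b,
    IsBigOOne ρs T φ fun y => (compTensorI φ (boundaryMetric γ) y)⁻¹ a b
  gs_bounded : ∀ φ ∈ Ξ, ∀ a b, IsBigOOne ρs T φ fun y => compTensorI φ gs y a b
  r_bounded : ∀ φ ∈ Ξ, ∀ a b, IsBigOOne ρs T φ fun y => compHTensorM φ r y a b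

/-- `μ` is the solution of `T = 2/μ - (2/(μπ)) arctan(4μ/ξ)`, `1/T ≤ μ < 2/T`, where for
`ξ = 0` the arctangent is read as its limit `π/2` (so that `μ = 1/T`). -/
def IsMu (T ξ μ : ℝ) : Prop :=
  1 / T ≤ μ ∧ μ < 2 / T ∧
    T = 2 / μ - 2 / (μ * Real.pi) * (if ξ = 0 then Real.pi / 2 else Real.arctan (4 * μ / ξ))

namespace Segment

variable {n : ℕ} {S : Type*} [TopologicalSpace S] [ChartedSpace (E n) S] {T : ℝ}
  (𝓜 : Segment n S T)

/-- The boundary metric `gm = -dt² + γ`. -/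
def gm : TensorI n S := boundaryMetric 𝓜.γ

/-- A function on `M`, in the coordinates `(ρ, t, x^A)`. -/
def inCoords (φ : OpenPartialHomeomorph S (E n)) (ζ : ℝ → ℝ → S → ℝ) (y : Coords n) : ℝ :=
  ζ y.1 y.2.1 (φ.symm y.2.2)

/-- `-gs - κ dt² - z gm`, evaluated at `(X, X)`. -/
def quadForm (κ z t : ℝ) (x : S) (X : ℝ × TS n x) : ℝ :=
  -𝓜.gs t x X X - κ * X.1 ^ 2 - z * 𝓜.gm t x X X

/-- The pseudoconvexity property. -/
def PseudoconvexityProperty : Prop :=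
  ∃ K > 0, ∃ ξ ≥ 0, ∃ μ, IsMu T ξ μ ∧ ∃ ζ : ℝ → ℝ → S → ℝ,
    (∀ φ ∈ charts n S, ContDiffOn ℝ ∞ (inCoords φ ζ) (coordDomain 𝓜.ρs T φ)) ∧
    (∀ φ ∈ 𝓜.Ξ, IsBigOOne 𝓜.ρs T φ (inCoords φ ζ)) ∧
    (∀ t ∈ Set.Ioo 0 (Real.pi * T), ∀ (x : S) (v : TS n x),
      |deriv (fun s => 𝓜.gm s x (0, v) (0, v)) t| ≤ ξ * 𝓜.gm t x (0, v) (0, v)) ∧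
    (∀ ρ ∈ Set.Ioo 0 𝓜.ρs, ∀ t ∈ Set.Ioo 0 (Real.pi * T), ∀ (x : S) (X : ℝ × TS n x),
      K * (X.1 ^ 2 + 𝓜.γ t x X.2 X.2) ≤ 𝓜.quadForm (μ ^ 2 + ξ ^ 2 / 16) (ζ ρ t x) t x X)

/-- The Einstein-vacuum equations `Ric[g] = -n g` on `M`. -/
def EinsteinVacuum : Prop :=
  ∀ ρ ∈ Set.Ioo 0 𝓜.ρs, ∀ t ∈ Set.Ioo 0 (Real.pi * T), ∀ (x : S) (X Y : ℝ × ℝ × TS n x),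
    ricciM 𝓜.g ρ t x X Y = -(n : ℝ) * 𝓜.g ρ t x X Y

/-- The boundary metric is static: `gm = -dt² + γ₀` with `γ₀` a fixed metric on `S`. -/
def IsStatic (γ₀ : TensorS n S) : Prop :=
  ∀ t ∈ Set.Ioo 0 (Real.pi * T), ∀ x, 𝓜.γ t x = γ₀ x

end Segment

end FGaAdS

end

/-! The heart of the matter is that the Einstein equations determine the second coefficient `gs`
from the boundary metric. For `g = ρ⁻² (dρ² + H)`, with `H = gm + ρ² gs + ρ³ r`, the tangential part
of `Ric[g] + n g` is `Ric[H]` plus terms in `H'` and `H''`; the `ρ⁻²` singularities cancel because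
the Einstein constant is `-n` (`ricciCoord_feffermanGraham`). Letting `ρ → 0` gives `Ric[gm] + (n -
2) gs + tr(gs) gm = 0` (`ricciCoord_boundary_of_einstein`).

For a static boundary, `Ric[-dt² + γ]` is the Ricci tensor of `γ` with no `dt` components. A trace
of the equation yields `tr gs = -R / (2 (n - 1))`, and hence `gs = -Ric / (n - 2) + s gm` with `s =
R / (2 (n - 1) (n - 2))` (`IsStatic.gs_apply`). What remains is algebra: `-gs + s gm = Ric / (n -
2)`, so a lower Ricci bound `C²` makes the spatial part at least `C² γ`, and subtracting `½ (C² +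
c²) gm` shares the gap `C² - c²` equally between time and space. Staticity allows `ξ = 0` and `μ = 1
/ T`, so `c = 1 / T < C` gives pseudoconvexity. Conversely, where `Ric ≤ 0`, testing on `∂_t` and on
a spatial vector forces `s + ζ` to be both positive and negative.

The analytic difficulty is the limit. The bounds on `r` are available only in the charts of `Ξ`,
whereas the curvature is computed in the preferred chart at each point. The bounds are therefore
carried through the coordinate change (`PullbackClass`); only bounds along each fixed ray `ρ → 0`
are required. -/

noncomputable section

namespace FGaAdS

/-! ### Calculus of partial derivatives and of inverse matrices. -/

section Calculus

variable {V : Type*} [NormedAddCommGroup V] [NormedSpace ℝ V] {U : Set V} {y : V}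

theorem differentiableAt_of_contDiffOn {F : V → ℝ} (hU : IsOpen U) (hF : ContDiffOn ℝ ∞ F U)
    (hy : y ∈ U) :
    DifferentiableAt ℝ F y :=
  (hF.contDiffAt (hU.mem_nhds hy)).differentiableAt (by simp)

theorem partialDeriv_congr {F F' : V → ℝ} (v : V) (hU : IsOpen U) (h : Set.EqOn F F' U)
    (hy : y ∈ U) : partialDeriv v F y = partialDeriv v F' y := by
  unfold partialDeriv
  rw [Filter.EventuallyEq.fderiv_eq (h.eventuallyEq_of_mem (hU.mem_nhds hy))]

theorem partialDeriv_const (v : V) (c : ℝ) : partialDeriv v (fun _ => c) y = 0 := by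
  simp [partialDeriv]

theorem partialDeriv_eq_zero_of_eqOn {F : V → ℝ} (v : V) {c : ℝ} (hU : IsOpen U)
    (h : ∀ z ∈ U, F z = c) (hy : y ∈ U) : partialDeriv v F y = 0 := by
  rw [partialDeriv_congr v hU (F' := fun _ => c) h hy, partialDeriv_const]

theorem partialDeriv_add {F F' : V → ℝ} (v : V) (hF : DifferentiableAt ℝ F y)
    (hF' : DifferentiableAt ℝ F' y) :
    partialDeriv v (fun z => F z + F' z) y = partialDeriv v F y + partialDeriv v F' y := by
  simp [partialDeriv, fderiv_fun_add hF hF']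

theorem partialDeriv_sub {F F' : V → ℝ} (v : V) (hF : DifferentiableAt ℝ F y)
    (hF' : DifferentiableAt ℝ F' y) :
    partialDeriv v (fun z => F z - F' z) y = partialDeriv v F y - partialDeriv v F' y := by
  simp [partialDeriv, fderiv_fun_sub hF hF']

theorem partialDeriv_mul {F F' : V → ℝ} (v : V) (hF : DifferentiableAt ℝ F y)
    (hF' : DifferentiableAt ℝ F' y) :
    partialDeriv v (fun z => F z * F' z) y
      = partialDeriv v F y * F' y + F y * partialDeriv v F' y := by
  simp [partialDeriv, fderiv_fun_mul hF hF']
  ring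

theorem partialDeriv_const_mul {F : V → ℝ} (v : V) (c : ℝ) (hF : DifferentiableAt ℝ F y) :
    partialDeriv v (fun z => c * F z) y = c * partialDeriv v F y := by
  rw [partialDeriv_mul v (differentiableAt_const c) hF, partialDeriv_const]
  ring

theorem partialDeriv_sum {κ : Type*} (s : Finset κ) {F : κ → V → ℝ} (v : V)
    (hF : ∀ i ∈ s, DifferentiableAt ℝ (F i) y) :
    partialDeriv v (fun z => ∑ i ∈ s, F i z) y = ∑ i ∈ s, partialDeriv v (F i) y := by
  simp [partialDeriv, fderiv_fun_sum hF]

theorem contDiffOn_partialDeriv {F : V → ℝ} (v : V) (hU : IsOpen U) (hF : ContDiffOn ℝ ∞ F U) :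
    ContDiffOn ℝ ∞ (partialDeriv v F) U :=
  (hF.fderiv_of_isOpen hU (m := ∞) (by simp)).clm_apply contDiffOn_const

variable {ι : Type*} [Fintype ι] [DecidableEq ι]

theorem contDiffOn_det {H : V → Matrix ι ι ℝ}
    (hH : ∀ a b, ContDiffOn ℝ ∞ (fun z => H z a b) U) :
    ContDiffOn ℝ ∞ (fun z => (H z).det) U := by
  simp only [Matrix.det_apply']
  exact ContDiffOn.sum fun σ _ => contDiffOn_const.mul (contDiffOn_prod fun i _ => hH _ _)

theorem contDiffOn_inv_apply {H : V → Matrix ι ι ℝ}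
    (hH : ∀ a b, ContDiffOn ℝ ∞ (fun z => H z a b) U) (hdet : ∀ z ∈ U, (H z).det ≠ 0) (a b : ι) :
    ContDiffOn ℝ ∞ (fun z => (H z)⁻¹ a b) U := by
  simp only [Matrix.inv_def, Ring.inverse_eq_inv', Matrix.smul_apply, smul_eq_mul]
  refine ((contDiffOn_det hH).inv hdet).mul ?_
  simp only [Matrix.adjugate_apply]
  refine contDiffOn_det fun c d => ?_
  by_cases hc : c = b
  · subst hc
    simpa using contDiffOn_const
  · simpa [Matrix.updateRow_ne hc] using hH c d

/-- Differentiate `H⁻¹ H = 1` entrywise and multiply by `H⁻¹` on the right. -/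
theorem partialDeriv_inv_apply {H : V → Matrix ι ι ℝ} (hU : IsOpen U)
    (hH : ∀ a b, ContDiffOn ℝ ∞ (fun z => H z a b) U) (hdet : ∀ z ∈ U, (H z).det ≠ 0)
    (hy : y ∈ U) (v : V) (a b : ι) :
    partialDeriv v (fun z => (H z)⁻¹ a b) y
      = -((H y)⁻¹ * (Matrix.of fun c d => partialDeriv v (fun z => H z c d) y) * (H y)⁻¹) a b := by
  set D : Matrix ι ι ℝ := Matrix.of fun c d => partialDeriv v (fun z => H z c d) y
  set D' : Matrix ι ι ℝ := Matrix.of fun c d => partialDeriv v (fun z => (H z)⁻¹ c d) y with hD'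
  have hu : ∀ z ∈ U, IsUnit (H z).det := fun z hz => (hdet z hz).isUnit
  have hI' := fun c d => differentiableAt_of_contDiffOn hU (contDiffOn_inv_apply hH hdet c d) hy
  have hH' := fun c d => differentiableAt_of_contDiffOn hU (hH c d) hy
  have key : D' * H y + (H y)⁻¹ * D = 0 := by
    ext c d
    have h1 : partialDeriv v (fun z => ((H z)⁻¹ * H z) c d) y = 0 :=
      partialDeriv_eq_zero_of_eqOn v hU (c := (1 : Matrix ι ι ℝ) c d)
        (fun z hz => by rw [Matrix.nonsing_inv_mul _ (hu z hz)]) hy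
    simp only [Matrix.mul_apply] at h1
    rw [partialDeriv_sum _ _ fun i _ =>
      (hI' c i).fun_mul (hH' i d)] at h1
    simp_rw [fun i => partialDeriv_mul v (hI' c i) (hH' i d)] at h1
    rw [Finset.sum_add_distrib] at h1
    simpa [Matrix.mul_apply, D, D'] using h1
  have : D' = -((H y)⁻¹ * D * (H y)⁻¹) := by
    have h2 : D' * H y * (H y)⁻¹ = -((H y)⁻¹ * D) * (H y)⁻¹ := by
      rw [eq_neg_of_add_eq_zero_left key]
    rwa [Matrix.mul_assoc, Matrix.mul_nonsing_inv _ (hu y hy), Matrix.mul_one,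
      Matrix.neg_mul] at h2
  have h3 := congrFun (congrFun this a) b
  simpa [hD'] using h3

end Calculus

/-! ### Ricci curvature as an algebraic function of the 2-jet of the metric. -/

section Algebraic

variable {ι : Type*} [Fintype ι]

/-- The Christoffel symbols as a function of the inverse metric `A` and the first derivatives
`D i a b = ∂_i G_{ab}`. -/
def christoffelAlg (A : Matrix ι ι ℝ) (D : ι → ι → ι → ℝ) (k i j : ι) : ℝ :=
  (1 / 2) * ∑ l, A k l * (D i j l + D j i l - D l i j)

/-- The derivative `∂_m Γ^k_{ij}` as a function of the inverse metric, the first derivatives and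
the second derivatives `D₂ m i a b = ∂_m ∂_i G_{ab}` of the metric. -/
def christoffelDerivAlg (A : Matrix ι ι ℝ) (D : ι → ι → ι → ℝ) (D₂ : ι → ι → ι → ι → ℝ)
    (m k i j : ι) : ℝ :=
  (1 / 2) * ∑ l, (-(A * Matrix.of (D m) * A) k l * (D i j l + D j i l - D l i j)
    + A k l * (D₂ m i j l + D₂ m j i l - D₂ m l i j))

/-- The Ricci curvature as a function of the inverse metric and of the first and second
derivatives of the metric. -/
def ricciAlg (A : Matrix ι ι ℝ) (D : ι → ι → ι → ℝ) (D₂ : ι → ι → ι → ι → ℝ) (i j : ι) : ℝ :=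
  ∑ k, (christoffelDerivAlg A D D₂ k k i j - christoffelDerivAlg A D D₂ j k i k
    + ∑ l, (christoffelAlg A D k k l * christoffelAlg A D l i j
      - christoffelAlg A D k j l * christoffelAlg A D l i k))

/-- Ricci is a polynomial in the inverse metric and the first two derivatives of the metric.
Pointwise convergence of these quantities is therefore enough; no convergence of metrics on open
sets is needed. -/
theorem tendsto_ricciAlg {X : Type*} {f : Filter X} {A : X → Matrix ι ι ℝ} {A₀ : Matrix ι ι ℝ}
    {D : X → ι → ι → ι → ℝ} {D₀ : ι → ι → ι → ℝ} {D₂ : X → ι → ι → ι → ι → ℝ}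
    {D₂₀ : ι → ι → ι → ι → ℝ} (hA : f.Tendsto A (nhds A₀))
    (hD : ∀ i a b, f.Tendsto (fun x => D x i a b) (nhds (D₀ i a b)))
    (hD₂ : ∀ m i a b, f.Tendsto (fun x => D₂ x m i a b) (nhds (D₂₀ m i a b))) (i j : ι) :
    f.Tendsto (fun x => ricciAlg (A x) (D x) (D₂ x) i j) (nhds (ricciAlg A₀ D₀ D₂₀ i j)) := by
  have hA' : ∀ a b, f.Tendsto (fun x => A x a b) (nhds (A₀ a b)) := fun a b =>
    tendsto_pi_nhds.1 (tendsto_pi_nhds.1 hA a) b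
  have hC : ∀ k i j, f.Tendsto (fun x => christoffelAlg (A x) (D x) k i j)
      (nhds (christoffelAlg A₀ D₀ k i j)) := fun k i j =>
    tendsto_const_nhds.mul (tendsto_finsetSum _ fun l _ =>
      (hA' k l).mul (((hD i j l).add (hD j i l)).sub (hD l i j)))
  have hM : ∀ m k l, f.Tendsto (fun x => (A x * Matrix.of (D x m) * A x) k l)
      (nhds ((A₀ * Matrix.of (D₀ m) * A₀) k l)) := by
    intro m k l
    simp only [Matrix.mul_apply, Matrix.of_apply]
    exact tendsto_finsetSum _ fun c _ =>
      (tendsto_finsetSum _ fun d _ => (hA' k d).mul (hD m d c)).mul (hA' c l)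
  have hC' : ∀ m k i j, f.Tendsto (fun x => christoffelDerivAlg (A x) (D x) (D₂ x) m k i j)
      (nhds (christoffelDerivAlg A₀ D₀ D₂₀ m k i j)) := fun m k i j =>
    tendsto_const_nhds.mul (tendsto_finsetSum _ fun l _ =>
      ((hM m k l).neg.mul (((hD i j l).add (hD j i l)).sub (hD l i j))).add
      ((hA' k l).mul (((hD₂ m i j l).add (hD₂ m j i l)).sub (hD₂ m l i j))))
  exact tendsto_finsetSum _ fun k _ => ((hC' k k i j).sub (hC' j k i k)).add
    (tendsto_finsetSum _ fun l _ => ((hC k k l).mul (hC l i j)).sub ((hC k j l).mul (hC l i k)))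

theorem tendsto_matrix_inv [DecidableEq ι] {X : Type*} {f : Filter X} {A : X → Matrix ι ι ℝ}
    {A₀ : Matrix ι ι ℝ} (hA : f.Tendsto A (nhds A₀)) (h₀ : A₀.det ≠ 0) :
    f.Tendsto (fun x => (A x)⁻¹) (nhds A₀⁻¹) := by
  simp only [Matrix.inv_def, Ring.inverse_eq_inv']
  have h1 := (continuous_id.matrix_det (n := ι) (R := ℝ)).tendsto A₀
  have h2 := (continuous_id.matrix_adjugate (n := ι) (R := ℝ)).tendsto A₀
  exact ((h1.comp hA).inv₀ h₀).smul (h2.comp hA)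

end Algebraic

/-! ### Coordinate curvature in terms of the 2-jet. -/

section Coordinates

variable {V : Type*} [NormedAddCommGroup V] [NormedSpace ℝ V] {U : Set V} {y : V}
  {ι : Type*} [Fintype ι] [DecidableEq ι]

theorem contDiffOn_christoffel (e : ι → V) {H : V → Matrix ι ι ℝ} (hU : IsOpen U)
    (hH : ∀ a b, ContDiffOn ℝ ∞ (fun z => H z a b) U) (hdet : ∀ z ∈ U, (H z).det ≠ 0)
    (k i j : ι) : ContDiffOn ℝ ∞ (christoffel e H k i j) U := by
  have hp := fun i a b => contDiffOn_partialDeriv (e i) hU (hH a b)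
  exact contDiffOn_const.mul (ContDiffOn.sum fun l _ => (contDiffOn_inv_apply hH hdet k l).mul
    (((hp i j l).add (hp j i l)).sub (hp l i j)))

theorem partialDeriv_christoffel (e : ι → V) {H : V → Matrix ι ι ℝ} (hU : IsOpen U)
    (hH : ∀ a b, ContDiffOn ℝ ∞ (fun z => H z a b) U) (hdet : ∀ z ∈ U, (H z).det ≠ 0)
    (hy : y ∈ U) (m k i j : ι) :
    partialDeriv (e m) (christoffel e H k i j) y
      = christoffelDerivAlg (H y)⁻¹ (fun i a b => partialDeriv (e i) (fun z => H z a b) y)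
        (fun m i a b => partialDeriv (e m) (partialDeriv (e i) (fun z => H z a b)) y) m k i j := by
  have hp := fun i a b => contDiffOn_partialDeriv (e i) hU (hH a b)
  have hp' := fun i a b => differentiableAt_of_contDiffOn hU (hp i a b) hy
  have hS : ∀ l, DifferentiableAt ℝ (fun z => partialDeriv (e i) (fun z => H z j l) z
      + partialDeriv (e j) (fun z => H z i l) z - partialDeriv (e l) (fun z => H z i j) z) y :=
    fun l => ((hp' i j l).fun_add (hp' j i l)).fun_sub (hp' l i j)
  have hI := fun l => differentiableAt_of_contDiffOn hU (contDiffOn_inv_apply hH hdet k l) hy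
  unfold christoffel christoffelDerivAlg
  rw [partialDeriv_const_mul, partialDeriv_sum]
  · congr 1
    refine Finset.sum_congr rfl fun l _ => ?_
    rw [partialDeriv_mul _ (hI l) (hS l),
      partialDeriv_sub _ ((hp' i j l).fun_add (hp' j i l)) (hp' l i j),
      partialDeriv_add _ (hp' i j l) (hp' j i l), partialDeriv_inv_apply hU hH hdet hy]
  · exact fun l _ => (hI l).fun_mul (hS l)
  · exact DifferentiableAt.fun_sum fun l _ =>
      (hI l).fun_mul (hS l)

/-- Trades the nested derivatives of Christoffel symbols for second derivatives of the metric, so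
that `tendsto_ricciAlg` applies. -/
theorem ricciCoord_eq_ricciAlg (e : ι → V) {H : V → Matrix ι ι ℝ} (hU : IsOpen U)
    (hH : ∀ a b, ContDiffOn ℝ ∞ (fun z => H z a b) U) (hdet : ∀ z ∈ U, (H z).det ≠ 0)
    (hy : y ∈ U) (i j : ι) :
    ricciCoord e H i j y
      = ricciAlg (H y)⁻¹ (fun i a b => partialDeriv (e i) (fun z => H z a b) y)
        (fun m i a b => partialDeriv (e m) (partialDeriv (e i) (fun z => H z a b)) y) i j := by
  unfold ricciCoord ricciAlg
  simp only [partialDeriv_christoffel e hU hH hdet hy]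
  rfl

end Coordinates

/-! ### Locality of curvature and invariance under rescaling. -/

section Congr

variable {V : Type*} [NormedAddCommGroup V] [NormedSpace ℝ V] {U : Set V} {y : V}
  {ι : Type*} [Fintype ι] [DecidableEq ι] (e : ι → V)

theorem christoffel_congr {G G' : V → Matrix ι ι ℝ} (hU : IsOpen U) (h : Set.EqOn G G' U)
    (k i j : ι) (hy : y ∈ U) : christoffel e G k i j y = christoffel e G' k i j y := by
  have hp : ∀ v a b, partialDeriv v (fun z => G z a b) y = partialDeriv v (fun z => G' z a b) y :=
    fun v a b => partialDeriv_congr v hU (fun z hz => by simp only [h hz]) hy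
  simp only [christoffel, hp, h hy]

/-- The metric enters Ricci only through its connection. This covers both equal metrics and metrics
that differ by a factor constant along the coordinate directions. -/
theorem ricciCoord_congr_of_christoffel {G G' : V → Matrix ι ι ℝ} (hU : IsOpen U)
    (h : ∀ k i j, Set.EqOn (christoffel e G k i j) (christoffel e G' k i j) U)
    (i j : ι) (hy : y ∈ U) : ricciCoord e G i j y = ricciCoord e G' i j y := by
  have hp : ∀ v k i j, partialDeriv v (christoffel e G k i j) y
      = partialDeriv v (christoffel e G' k i j) y :=
    fun v k i j => partialDeriv_congr v hU (h k i j) hy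
  have h' := fun k i j => h k i j hy
  simp only [ricciCoord, hp, h']

theorem ricciCoord_congr {G G' : V → Matrix ι ι ℝ} (hU : IsOpen U) (h : Set.EqOn G G' U)
    (i j : ι) (hy : y ∈ U) : ricciCoord e G i j y = ricciCoord e G' i j y :=
  ricciCoord_congr_of_christoffel e hU (fun k i j _ hz => christoffel_congr e hU h k i j hz) i j hy

/-- The Ricci curvature is unchanged by a locally constant rescaling of the metric. -/
theorem ricciCoord_smul {H : V → Matrix ι ι ℝ} {s : V → ℝ} (hU : IsOpen U)
    (hH : ∀ a b, ContDiffOn ℝ ∞ (fun z => H z a b) U) (hdet : ∀ z ∈ U, (H z).det ≠ 0)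
    (hs : ∀ z ∈ U, DifferentiableAt ℝ s z) (hs0 : ∀ z ∈ U, s z ≠ 0)
    (hse : ∀ z ∈ U, ∀ i, partialDeriv (e i) s z = 0) (i j : ι) (hy : y ∈ U) :
    ricciCoord e (fun z => s z • H z) i j y = ricciCoord e H i j y := by
  refine ricciCoord_congr_of_christoffel e hU (fun k i j z hz => ?_) i j hy
  have hinv : (s z • H z)⁻¹ = (s z)⁻¹ • (H z)⁻¹ := by
    refine Matrix.inv_eq_right_inv ?_
    rw [Matrix.smul_mul, Matrix.mul_smul, smul_smul, mul_inv_cancel₀ (hs0 z hz), one_smul,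
      Matrix.mul_nonsing_inv _ (hdet z hz).isUnit]
  -- The factor is constant only in the directions `e i`, which are the only ones that the
  -- Christoffel symbols see; it then cancels against the inverse metric.
  have hp : ∀ i a b, partialDeriv (e i) (fun z => s z * H z a b) z
      = s z * partialDeriv (e i) (fun z => H z a b) z := by
    intro i a b
    have := partialDeriv_mul (e i) (hs z hz) (differentiableAt_of_contDiffOn hU (hH a b) hz)
    simpa [hse z hz] using this
  simp only [christoffel, hp, hinv, Matrix.smul_apply, smul_eq_mul]
  congr 1
  refine Finset.sum_congr rfl fun l _ => ?_
  have := hs0 z hz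
  field_simp

end Congr

/-! ### Curvature of block diagonal metrics. -/

section Block

variable {ι : Type*}

/-- The block diagonal matrix with blocks `α` and `B`. -/
def blockOption (α : ℝ) (B : Matrix ι ι ℝ) : Matrix (Option ι) (Option ι) ℝ :=
  Matrix.of fun i j => match i, j with
    | none, none => α
    | some a, some b => B a b
    | none, some _ => 0
    | some _, none => 0

@[simp] theorem blockOption_none_none (α : ℝ) (B : Matrix ι ι ℝ) :
    blockOption α B none none = α := rfl

@[simp] theorem blockOption_some_some (α : ℝ) (B : Matrix ι ι ℝ) (a b : ι) :
    blockOption α B (some a) (some b) = B a b := rfl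

@[simp] theorem blockOption_none_some (α : ℝ) (B : Matrix ι ι ℝ) (b : ι) :
    blockOption α B none (some b) = 0 := rfl

@[simp] theorem blockOption_some_none (α : ℝ) (B : Matrix ι ι ℝ) (a : ι) :
    blockOption α B (some a) none = 0 := rfl

variable [Fintype ι] [DecidableEq ι]

theorem blockOption_mul_inv {α : ℝ} {B : Matrix ι ι ℝ} (hα : α ≠ 0) (hB : B.det ≠ 0) :
    blockOption α B * blockOption α⁻¹ B⁻¹ = 1 := by
  have h := Matrix.mul_nonsing_inv B hB.isUnit
  ext i j
  rcases i with _ | a <;> rcases j with _ | b <;>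
    simp [Matrix.mul_apply, Fintype.sum_option, hα, Matrix.one_apply]
  rw [← Matrix.mul_apply, h, Matrix.one_apply]

theorem blockOption_inv {α : ℝ} {B : Matrix ι ι ℝ} (hα : α ≠ 0) (hB : B.det ≠ 0) :
    (blockOption α B)⁻¹ = blockOption α⁻¹ B⁻¹ :=
  Matrix.inv_eq_right_inv (blockOption_mul_inv hα hB)

theorem blockOption_det_ne_zero {α : ℝ} {B : Matrix ι ι ℝ} (hα : α ≠ 0) (hB : B.det ≠ 0) :
    (blockOption α B).det ≠ 0 :=
  (Matrix.isUnit_det_of_right_inverse (blockOption_mul_inv hα hB)).ne_zero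

variable {V : Type*} [NormedAddCommGroup V] [NormedSpace ℝ V] {U : Set V} {y : V}
  (e : Option ι → V) {α : V → ℝ} {B : V → Matrix ι ι ℝ}

section Pointwise

variable (hα : α y ≠ 0) (hdet : (B y).det ≠ 0)
  (hαs : ∀ a, partialDeriv (e (some a)) α y = 0)

include hα hdet

theorem christoffel_block_none_none_none :
    christoffel e (fun z => blockOption (α z) (B z)) none none none y
      = (1 / 2) * ((α y)⁻¹ * partialDeriv (e none) α y) := by
  simp [christoffel, blockOption_inv hα hdet, Fintype.sum_option]

theorem christoffel_block_none_some_some (a b : ι) :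
    christoffel e (fun z => blockOption (α z) (B z)) none (some a) (some b) y
      = -(1 / 2) * ((α y)⁻¹ * partialDeriv (e none) (fun z => B z a b) y) := by
  simp [christoffel, blockOption_inv hα hdet, Fintype.sum_option, partialDeriv_const]

theorem christoffel_block_some_none_some (c a : ι) :
    christoffel e (fun z => blockOption (α z) (B z)) (some c) none (some a) y
      = (1 / 2) * ∑ d, (B y)⁻¹ c d * partialDeriv (e none) (fun z => B z a d) y := by
  simp [christoffel, blockOption_inv hα hdet, Fintype.sum_option, partialDeriv_const]

theorem christoffel_block_some_some_none (c a : ι) :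
    christoffel e (fun z => blockOption (α z) (B z)) (some c) (some a) none y
      = (1 / 2) * ∑ d, (B y)⁻¹ c d * partialDeriv (e none) (fun z => B z a d) y := by
  simp [christoffel, blockOption_inv hα hdet, Fintype.sum_option, partialDeriv_const]

theorem christoffel_block_some_some_some (c a b : ι) :
    christoffel e (fun z => blockOption (α z) (B z)) (some c) (some a) (some b) y
      = christoffel (fun a => e (some a)) B c a b y := by
  simp [christoffel, blockOption_inv hα hdet, Fintype.sum_option]

include hαs

theorem christoffel_block_none_none_some (a : ι) :
    christoffel e (fun z => blockOption (α z) (B z)) none none (some a) y = 0 := by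
  simp [christoffel, blockOption_inv hα hdet, Fintype.sum_option, partialDeriv_const, hαs]

theorem christoffel_block_none_some_none (a : ι) :
    christoffel e (fun z => blockOption (α z) (B z)) none (some a) none y = 0 := by
  simp [christoffel, blockOption_inv hα hdet, Fintype.sum_option, partialDeriv_const, hαs]

theorem christoffel_block_some_none_none (a : ι) :
    christoffel e (fun z => blockOption (α z) (B z)) (some a) none none y = 0 := by
  simp [christoffel, blockOption_inv hα hdet, Fintype.sum_option, partialDeriv_const, hαs]

end Pointwise

/-- The Ricci curvature of `α (dx⁰)² + B`, with `α` depending on `x⁰` only, in the directions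
of the second block. -/
theorem ricciCoord_block_some_some (hU : IsOpen U) (hα : ∀ z ∈ U, α z ≠ 0)
    (hdet : ∀ z ∈ U, (B z).det ≠ 0) (hαs : ∀ z ∈ U, ∀ a, partialDeriv (e (some a)) α z = 0)
    (hy : y ∈ U) (a b : ι) {P Q : V → ι → ι → ℝ}
    (hP : ∀ z ∈ U, ∀ a b,
      P z a b = -(1 / 2) * ((α z)⁻¹ * partialDeriv (e none) (fun z => B z a b) z))
    (hQ : ∀ z ∈ U, ∀ c a,
      Q z c a = (1 / 2) * ∑ d, (B z)⁻¹ c d * partialDeriv (e none) (fun z => B z a d) z) :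
    ricciCoord e (fun z => blockOption (α z) (B z)) (some a) (some b) y
      = ricciCoord (fun a => e (some a)) B a b y + partialDeriv (e none) (fun z => P z a b) y
        + (1 / 2) * ((α y)⁻¹ * partialDeriv (e none) α y) * P y a b
        - ∑ c, P y b c * Q y c a + (∑ c, Q y c c) * P y a b - ∑ c, Q y c b * P y a c := by
  -- `P` is `Γ^0_{ab}` and `Q` is `Γ^c_{a0}`, up to sign the second fundamental form of the slices
  -- and its index-raised version. Leaving them as parameters lets a caller supply closed forms that
  -- are easy to differentiate.
  set G : V → Matrix (Option ι) (Option ι) ℝ := fun z => blockOption (α z) (B z) with hG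
  have d1 : partialDeriv (e none) (christoffel e G none (some a) (some b)) y
      = partialDeriv (e none) (fun z => P z a b) y :=
    partialDeriv_congr _ hU (fun z hz => by
      simp only [hP z hz, hG, christoffel_block_none_some_some e (hα z hz) (hdet z hz)]) hy
  have d2 : partialDeriv (e (some b)) (christoffel e G none (some a) none) y = 0 :=
    partialDeriv_eq_zero_of_eqOn _ hU (fun z hz =>
      christoffel_block_none_some_none e (hα z hz) (hdet z hz) (hαs z hz) a) hy
  have d3 : ∀ m c a b, partialDeriv m (christoffel e G (some c) (some a) (some b)) y
      = partialDeriv m (christoffel (fun a => e (some a)) B c a b) y := fun m c a b =>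
    partialDeriv_congr _ hU (fun z hz =>
      christoffel_block_some_some_some e (hα z hz) (hdet z hz) c a b) hy
  have c1 := christoffel_block_none_none_none e (hα y hy) (hdet y hy)
  have c2 : ∀ a b, christoffel e G none (some a) (some b) y = P y a b := fun a b => by
    simp only [hP y hy, hG, christoffel_block_none_some_some e (hα y hy) (hdet y hy)]
  have c4 : ∀ c a, christoffel e G (some c) (some a) none y = Q y c a := fun c a => by
    simp only [hQ y hy, hG, christoffel_block_some_some_none e (hα y hy) (hdet y hy)]
  have c5 := christoffel_block_none_none_some e (hα y hy) (hdet y hy) (hαs y hy)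
  have c6 := christoffel_block_none_some_none e (hα y hy) (hdet y hy) (hαs y hy)
  have c7 := christoffel_block_some_some_some e (hα y hy) (hdet y hy)
  rw [← hG] at c1 c5 c6 c7
  simp only [ricciCoord, Fintype.sum_option, d1, d2, d3, c1, c2, c4, c5, c6, c7]
  simp only [Finset.sum_add_distrib, Finset.sum_sub_distrib, Finset.sum_mul,
    zero_mul, mul_zero, Finset.sum_const_zero]
  ring

/-- A product metric `α (dx⁰)² + B` with constant `α` and with `B` independent of `x⁰` has no
curvature in the direction of `x⁰`. -/
theorem ricciCoord_block_none (hU : IsOpen U) (hα : ∀ z ∈ U, α z ≠ 0)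
    (hdet : ∀ z ∈ U, (B z).det ≠ 0) (hαs : ∀ z ∈ U, ∀ i, partialDeriv (e i) α z = 0)
    (hB : ∀ z ∈ U, ∀ a b, partialDeriv (e none) (fun z => B z a b) z = 0)
    (hy : y ∈ U) (j : Option ι) :
    ricciCoord e (fun z => blockOption (α z) (B z)) none j y = 0 := by
  -- Every term of `Ric_{0j}` contains, possibly differentiated, a Christoffel symbol whose first
  -- lower index is `0`; all of these vanish.
  have h0 : ∀ z ∈ U, ∀ k j,
      christoffel e (fun z => blockOption (α z) (B z)) k none j z = 0 := by
    intro z hz k j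
    rcases k with _ | c <;> rcases j with _ | a
    · rw [christoffel_block_none_none_none e (hα z hz) (hdet z hz), hαs z hz]
      simp
    · exact christoffel_block_none_none_some e (hα z hz) (hdet z hz) (fun a => hαs z hz _) a
    · exact christoffel_block_some_none_none e (hα z hz) (hdet z hz) (fun a => hαs z hz _) c
    · rw [christoffel_block_some_none_some e (hα z hz) (hdet z hz)]
      simp [hB z hz]
  have d0 : ∀ m k j, partialDeriv m
      (christoffel e (fun z => blockOption (α z) (B z)) k none j) y = 0 := fun m k j =>
    partialDeriv_eq_zero_of_eqOn _ hU (fun z hz => h0 z hz k j) hy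
  simp [ricciCoord, d0, h0 y hy]

/-- The slices are totally geodesic: `P = Q = 0` in the block formula. -/
theorem ricciCoord_block_some_some_of_static (hU : IsOpen U) (hα : ∀ z ∈ U, α z ≠ 0)
    (hdet : ∀ z ∈ U, (B z).det ≠ 0) (hαs : ∀ z ∈ U, ∀ i, partialDeriv (e i) α z = 0)
    (hB : ∀ z ∈ U, ∀ a b, partialDeriv (e none) (fun z => B z a b) z = 0)
    (hy : y ∈ U) (a b : ι) :
    ricciCoord e (fun z => blockOption (α z) (B z)) (some a) (some b) y
      = ricciCoord (fun a => e (some a)) B a b y := by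
  rw [ricciCoord_block_some_some e hU hα hdet (fun z hz a => hαs z hz _) hy a b
    (P := fun _ _ _ => 0) (Q := fun _ _ _ => 0) (fun z hz a b => by simp [hB z hz])
    (fun z hz a b => by simp [hB z hz])]
  simp [partialDeriv_const]

end Block

/-! ### Curvature of a metric in Fefferman-Graham gauge. -/

section FeffermanGraham

variable {W : Type*} [NormedAddCommGroup W] [NormedSpace ℝ W] {U : Set (ℝ × W)} {y : ℝ × W}
  {ι : Type*} [Fintype ι] [DecidableEq ι]

/-- The coordinate directions of `ℝ × W`, given coordinate directions of `W`. -/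
def extendDir (f : ι → W) : Option ι → ℝ × W
  | none => (1, 0)
  | some a => (0, f a)

theorem partialDeriv_comp_fst {F : ℝ → ℝ} (hF : DifferentiableAt ℝ F y.1) (v : ℝ × W) :
    partialDeriv v (fun z => F z.1) y = v.1 * deriv F y.1 := by
  have h := (hF.hasDerivAt.comp_hasFDerivAt y (hasFDerivAt_fst (𝕜 := ℝ) (E := ℝ) (F := W)))
  have h' : HasFDerivAt (fun z : ℝ × W => F z.1) _ y := h
  rw [partialDeriv, h'.fderiv]
  simp [mul_comm]

/-- The block formula with `α = ρ⁻²` and `B = ρ⁻² H`. Adding `card ι` times the metric cancels all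
`ρ⁻² H` terms, so the worst remaining factor is `ρ⁻¹`, and it always comes with `D = ∂_ρ H`. This is
what makes the limit at the boundary finite when `D = O(ρ)`. -/
theorem ricciCoord_feffermanGraham (f : ι → W) {H : ℝ × W → Matrix ι ι ℝ} (hU : IsOpen U)
    (hpos : ∀ z ∈ U, 0 < z.1)
    (hH : ∀ a b, ContDiffOn ℝ ∞ (fun z => H z a b) U) (hdet : ∀ z ∈ U, (H z).det ≠ 0)
    (hsymm : ∀ z ∈ U, ∀ a b, H z a b = H z b a) (hy : y ∈ U) (a b : ι)
    {D D₂ : Matrix ι ι ℝ}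
    (hD : ∀ a b, D a b = partialDeriv (1, 0) (fun z => H z a b) y)
    (hD₂ : D₂ a b = partialDeriv (1, 0) (partialDeriv (1, 0) (fun z => H z a b)) y) :
    ricciCoord (extendDir f) (fun z => blockOption (z.1 ^ 2)⁻¹ ((z.1 ^ 2)⁻¹ • H z))
        (some a) (some b) y + Fintype.card ι * ((y.1 ^ 2)⁻¹ * H y a b)
      = ricciCoord (fun a => ((0, f a) : ℝ × W)) H a b y - (1 / 2) * D₂ a b
        + (Fintype.card ι - 1) / 2 * (y.1⁻¹ * D a b)
        + (1 / 2) * (y.1⁻¹ * ((H y)⁻¹ * D).trace) * H y a b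
        + (1 / 2) * (D * (H y)⁻¹ * D) a b - (1 / 4) * ((H y)⁻¹ * D).trace * D a b := by
  have hne : ∀ z ∈ U, z.1 ≠ 0 := fun z hz => (hpos z hz).ne'
  have hs : ∀ r : ℝ, r ≠ 0 → HasDerivAt (fun r : ℝ => (r ^ 2)⁻¹) (-2 * (r ^ 3)⁻¹) r := by
    intro r hr
    refine ((hasDerivAt_pow 2 r).fun_inv (pow_ne_zero 2 hr)).congr_deriv ?_
    norm_num
    field_simp
  have hi : ∀ r : ℝ, r ≠ 0 → HasDerivAt (fun r : ℝ => r⁻¹) (-(r ^ 2)⁻¹) r :=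
    fun r hr => hasDerivAt_inv hr
  have hsd : ∀ z ∈ U, DifferentiableAt ℝ (fun z : ℝ × W => (z.1 ^ 2)⁻¹) z := fun z hz =>
    (hs z.1 (hne z hz)).differentiableAt.comp z differentiableAt_fst
  have hid : ∀ z ∈ U, DifferentiableAt ℝ (fun z : ℝ × W => z.1⁻¹) z := fun z hz =>
    (hi z.1 (hne z hz)).differentiableAt.comp z differentiableAt_fst
  have hs' : ∀ z ∈ U, ∀ v : ℝ × W, partialDeriv v (fun z : ℝ × W => (z.1 ^ 2)⁻¹) z
      = v.1 * (-2 * (z.1 ^ 3)⁻¹) := fun z hz v => by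
    rw [partialDeriv_comp_fst (F := fun r => (r ^ 2)⁻¹) (hs z.1 (hne z hz)).differentiableAt,
      (hs z.1 (hne z hz)).deriv]
  have hi' : ∀ z ∈ U, ∀ v : ℝ × W, partialDeriv v (fun z : ℝ × W => z.1⁻¹) z
      = v.1 * (-(z.1 ^ 2)⁻¹) := fun z hz v => by
    rw [partialDeriv_comp_fst (F := fun r => r⁻¹) (hi z.1 (hne z hz)).differentiableAt,
      (hi z.1 (hne z hz)).deriv]
  have hHd := fun z hz a b => differentiableAt_of_contDiffOn hU (hH a b) (y := z) hz
  have hH'd := fun z hz a b => differentiableAt_of_contDiffOn hU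
    (contDiffOn_partialDeriv (1, 0) hU (hH a b)) (y := z) hz
  have hB : ∀ z ∈ U, ∀ a b, partialDeriv (1, 0) (fun z => ((z.1 ^ 2)⁻¹ • H z) a b) z
      = -2 * (z.1 ^ 3)⁻¹ * H z a b + (z.1 ^ 2)⁻¹ * partialDeriv (1, 0) (fun z => H z a b) z := by
    intro z hz a b
    have := partialDeriv_mul (1, 0) (hsd z hz) (hHd z hz a b)
    rw [hs' z hz] at this
    simpa using this
  have hBdet : ∀ z ∈ U, ((z.1 ^ 2)⁻¹ • H z).det ≠ 0 := by
    intro z hz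
    rw [Matrix.det_smul]
    exact mul_ne_zero (pow_ne_zero _ (inv_ne_zero (pow_ne_zero _ (hne z hz)))) (hdet z hz)
  have hBinv : ∀ z ∈ U, ((z.1 ^ 2)⁻¹ • H z)⁻¹ = z.1 ^ 2 • (H z)⁻¹ := by
    intro z hz
    refine Matrix.inv_eq_right_inv ?_
    rw [Matrix.smul_mul, Matrix.mul_smul, smul_smul,
      inv_mul_cancel₀ (pow_ne_zero _ (hne z hz)), one_smul,
      Matrix.mul_nonsing_inv _ (hdet z hz).isUnit]
  -- Here `Γ^0_{ab} = ρ⁻¹ H - ½ H'` and `Γ^c_{a0} = ½ H⁻¹ H' - ρ⁻¹ δ`.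
  have hric := ricciCoord_block_some_some (extendDir f) (α := fun z => (z.1 ^ 2)⁻¹)
    (B := fun z => (z.1 ^ 2)⁻¹ • H z) hU
    (fun z hz => inv_ne_zero (pow_ne_zero _ (hne z hz))) hBdet
    (fun z hz a => by rw [hs' z hz]; simp [extendDir]) hy a b
    (P := fun z a b => z.1⁻¹ * H z a b - (1 / 2) * partialDeriv (1, 0) (fun z => H z a b) z)
    (Q := fun z c a => (1 / 2) * ((H z)⁻¹ * Matrix.of fun a b =>
        partialDeriv (1, 0) (fun z => H z a b) z) c a - z.1⁻¹ * (1 : Matrix ι ι ℝ) c a)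
    (fun z hz a b => by
      have := hne z hz
      simp only [extendDir, hB z hz]
      field_simp
      ring)
    (fun z hz c a => by
      have h1 := hne z hz
      have h2 : ∀ d, partialDeriv (1, 0) (fun z => H z a d) z
          = partialDeriv (1, 0) (fun z => H z d a) z := fun d =>
        partialDeriv_congr _ hU (fun z hz => hsymm z hz a d) hz
      simp only [extendDir, hB z hz, hBinv z hz]
      rw [← Matrix.nonsing_inv_mul _ (hdet z hz).isUnit]
      simp only [Matrix.mul_apply, Matrix.of_apply, Matrix.smul_apply, smul_eq_mul,
        Finset.mul_sum, ← Finset.sum_sub_distrib, h2, hsymm z hz a]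
      refine Finset.sum_congr rfl fun d _ => ?_
      field_simp
      ring)
  -- The factor `ρ⁻²` is constant on each slice, so the intrinsic Ricci term is that of `H`.
  have hsm := ricciCoord_smul (fun a => ((0, f a) : ℝ × W)) (s := fun z => (z.1 ^ 2)⁻¹) hU hH hdet
    hsd (fun z hz => inv_ne_zero (pow_ne_zero _ (hne z hz)))
    (fun z hz i => by rw [hs' z hz]; simp) a b hy
  have hPd : partialDeriv (1, 0) (fun z => z.1⁻¹ * H z a b
        - (1 / 2) * partialDeriv (1, 0) (fun z => H z a b) z) y
      = -(y.1 ^ 2)⁻¹ * H y a b + y.1⁻¹ * D a b - (1 / 2) * D₂ a b := by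
    rw [partialDeriv_sub _ ((hid y hy).fun_mul (hHd y hy a b)) ((hH'd y hy a b).const_mul _),
      partialDeriv_mul _ (hid y hy) (hHd y hy a b), partialDeriv_const_mul _ _ (hH'd y hy a b),
      hi' y hy, hD, hD₂]
    simp
  have hDs : ∀ a b, D a b = D b a := fun a b => by
    rw [hD, hD]
    exact partialDeriv_congr _ hU (fun z hz => hsymm z hz a b) hy
  have hDof : (Matrix.of fun a b => partialDeriv (1, 0) (fun z => H z a b) y) = D := by
    ext a b
    rw [Matrix.of_apply, hD]
  set h := H y with hh
  set A := h⁻¹ with hA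
  have hhA : h * A = 1 := Matrix.mul_nonsing_inv _ (hdet y hy).isUnit
  have hDt : D.transpose = D := by ext a b; exact hDs b a
  have hht : h.transpose = h := by ext a b; exact hsymm y hy b a
  have hAt : A.transpose = A := by rw [hA, Matrix.transpose_nonsing_inv, hht]
  have hDAD : (D * A * D) b a = (D * A * D) a b := by
    rw [← Matrix.transpose_apply (D * A * D), Matrix.transpose_mul, Matrix.transpose_mul, hDt,
      hAt, Matrix.mul_assoc]
  -- The matrix product `P Q`. Both quadratic sums of the block formula reduce to it, since `H`, `D`
  -- and `D H⁻¹ D` are symmetric.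
  have hPQ : ∀ a b, ∑ c, (y.1⁻¹ * h a c - 1 / 2 * D a c)
        * (1 / 2 * (A * D) c b - y.1⁻¹ * (1 : Matrix ι ι ℝ) c b)
      = y.1⁻¹ * D a b - (y.1 ^ 2)⁻¹ * h a b - 1 / 4 * (D * A * D) a b := by
    intro a b
    have hm : (y.1⁻¹ • h - (1 / 2 : ℝ) • D) * ((1 / 2 : ℝ) • (A * D) - y.1⁻¹ • (1 : Matrix ι ι ℝ))
        = y.1⁻¹ • D - (y.1 ^ 2)⁻¹ • h - (1 / 4 : ℝ) • (D * A * D) := by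
      have h1 : h * (A * D) = D := by rw [← Matrix.mul_assoc, hhA, Matrix.one_mul]
      have h2 : D * (A * D) = D * A * D := (Matrix.mul_assoc _ _ _).symm
      simp only [Matrix.sub_mul, Matrix.mul_sub, Matrix.smul_mul, Matrix.mul_smul, Matrix.mul_one,
        h1, h2]
      module
    have := congrFun (congrFun hm a) b
    simpa [Matrix.mul_apply] using this
  have htr : ∑ c, (1 / 2 * (A * D) c c - y.1⁻¹ * (1 : Matrix ι ι ℝ) c c)
      = 1 / 2 * (A * D).trace - Fintype.card ι * y.1⁻¹ := by
    rw [Finset.sum_sub_distrib, ← Finset.mul_sum]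
    simp [Matrix.trace]
  have hyn := hne y hy
  simp only [hDof] at hric
  simp only [← hD] at hric
  have hPQ' : ∑ c, (1 / 2 * (A * D) c b - y.1⁻¹ * (1 : Matrix ι ι ℝ) c b)
      * (y.1⁻¹ * h a c - 1 / 2 * D a c) = _ :=
    (Finset.sum_congr rfl fun c _ => mul_comm _ _).trans (hPQ a b)
  have hhs : h b a = h a b := hsymm y hy b a
  rw [hric, htr, hPQ, hPQ', hDAD, hDs b a, hhs]
  simp only [extendDir, hs' y hy, hPd, hsm]
  field_simp
  ring

end FeffermanGraham

/-! ### The limit of the Einstein equations at the boundary. -/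

section Limit

open Filter Topology

variable {W : Type*} [NormedAddCommGroup W] [NormedSpace ℝ W]

theorem partialDeriv_comp_snd {F : W → ℝ} {y : ℝ × W} (hF : DifferentiableAt ℝ F y.2)
    (v : ℝ × W) : partialDeriv v (fun z : ℝ × W => F z.2) y = partialDeriv v.2 F y.2 := by
  have h := hF.hasFDerivAt.comp y (hasFDerivAt_snd (𝕜 := ℝ) (E := ℝ) (F := W))
  have h' : HasFDerivAt (fun z : ℝ × W => F z.2) _ y := h
  rw [partialDeriv, h'.fderiv]
  rfl

/-- `x ↦ F x + ρ² G x + ρ³ R (ρ, x)`, as a function of `(ρ, x)`. -/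
def cubicExpansion (F G : W → ℝ) (R : ℝ × W → ℝ) (z : ℝ × W) : ℝ :=
  F z.2 + z.1 ^ 2 * G z.2 + z.1 ^ 3 * R z

variable {ρs : ℝ} {Ω : Set W} {F G : W → ℝ} {R : ℝ × W → ℝ}

theorem contDiffOn_cubicExpansion (hF : ContDiffOn ℝ ∞ F Ω) (hG : ContDiffOn ℝ ∞ G Ω)
    (hR : ContDiffOn ℝ ∞ R (Set.Ioo 0 ρs ×ˢ Ω)) :
    ContDiffOn ℝ ∞ (cubicExpansion F G R) (Set.Ioo 0 ρs ×ˢ Ω) := by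
  have h2 : Set.MapsTo (Prod.snd : ℝ × W → W) (Set.Ioo 0 ρs ×ˢ Ω) Ω := fun z hz => hz.2
  exact ((hF.comp contDiff_snd.contDiffOn h2).add ((contDiff_fst.pow 2).contDiffOn.mul
    (hG.comp contDiff_snd.contDiffOn h2))).add ((contDiff_fst.pow 3).contDiffOn.mul hR)

theorem partialDeriv_fst_pow (k : ℕ) (v y : ℝ × W) :
    partialDeriv v (fun z : ℝ × W => z.1 ^ k) y = v.1 * (k * y.1 ^ (k - 1)) := by
  rw [partialDeriv_comp_fst (F := fun r => r ^ k) (by fun_prop)]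
  simp

/-- Directions without a `ρ` component act coefficientwise and preserve the form of the expansion,
so they can be iterated; only the `ρ` direction contributes extra terms. -/
theorem partialDeriv_cubicExpansion (hΩ : IsOpen Ω) (hF : ContDiffOn ℝ ∞ F Ω)
    (hG : ContDiffOn ℝ ∞ G Ω) (hR : ContDiffOn ℝ ∞ R (Set.Ioo 0 ρs ×ˢ Ω)) (v : ℝ × W)
    {y : ℝ × W} (hy : y ∈ Set.Ioo 0 ρs ×ˢ Ω) :
    partialDeriv v (cubicExpansion F G R) y
      = cubicExpansion (partialDeriv v.2 F) (partialDeriv v.2 G) (partialDeriv v R) y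
        + v.1 * (2 * y.1 * G y.2 + 3 * y.1 ^ 2 * R y) := by
  have hF' := differentiableAt_of_contDiffOn hΩ hF hy.2
  have hG' := differentiableAt_of_contDiffOn hΩ hG hy.2
  have hR' := differentiableAt_of_contDiffOn (isOpen_Ioo.prod hΩ) hR hy
  have hF2 : DifferentiableAt ℝ (fun z : ℝ × W => F z.2) y := hF'.comp y differentiableAt_snd
  have hG2 : DifferentiableAt ℝ (fun z : ℝ × W => G z.2) y := hG'.comp y differentiableAt_snd
  have hp : ∀ k : ℕ, DifferentiableAt ℝ (fun z : ℝ × W => z.1 ^ k) y := fun k => by fun_prop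
  unfold cubicExpansion
  rw [partialDeriv_add _ (hF2.fun_add ((hp 2).fun_mul hG2)) ((hp 3).fun_mul hR'),
    partialDeriv_add _ hF2 ((hp 2).fun_mul hG2), partialDeriv_mul _ (hp 2) hG2,
    partialDeriv_mul _ (hp 3) hR', partialDeriv_comp_snd hF', partialDeriv_comp_snd hG',
    partialDeriv_fst_pow, partialDeriv_fst_pow]
  norm_num
  ring

/-- Derivatives in `ρ` of the remainder may blow up like `ρ⁻ᵏ`; a prefactor of strictly higher power
absorbs this. -/
theorem tendsto_pow_mul_zero (hρs : 0 < ρs) {q : ℝ → ℝ} {k j : ℕ} (hkj : k < j)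
    (hq : ∃ K, ∀ ρ ∈ Set.Ioo 0 ρs, |q ρ| ≤ K * (ρ ^ k)⁻¹) :
    Tendsto (fun ρ => ρ ^ j * q ρ) (𝓝[>] 0) (𝓝 0) := by
  obtain ⟨K, hK⟩ := hq
  have h0 : Tendsto (fun ρ : ℝ => K * ρ ^ (j - k)) (𝓝[>] 0) (𝓝 0) := by
    have : Continuous fun ρ : ℝ => K * ρ ^ (j - k) := by fun_prop
    have h := this.tendsto 0
    rw [zero_pow (by omega), mul_zero] at h
    exact h.mono_left nhdsWithin_le_nhds
  refine squeeze_zero_norm' ?_ h0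
  filter_upwards [Ioo_mem_nhdsGT hρs] with ρ hρ
  have hp : 0 < ρ := hρ.1
  rw [Real.norm_eq_abs, abs_mul, abs_of_pos (pow_pos hp j)]
  calc ρ ^ j * |q ρ| ≤ ρ ^ j * (K * (ρ ^ k)⁻¹) :=
        mul_le_mul_of_nonneg_left (hK ρ hρ) (pow_pos hp j).le
    _ = K * ρ ^ (j - k) := by
        have : ρ ^ j = ρ ^ (j - k) * ρ ^ k := by rw [← pow_add]; congr 1; omega
        rw [this]
        have := (pow_pos hp k).ne'
        field_simp

theorem tendsto_pow_nhdsGT_zero {k : ℕ} (hk : k ≠ 0) :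
    Tendsto (fun ρ : ℝ => ρ ^ k) (𝓝[>] 0) (𝓝 0) := by
  have h := (continuous_pow k (M := ℝ)).tendsto 0
  rw [zero_pow hk] at h
  exact h.mono_left nhdsWithin_le_nhds

theorem tendsto_cubicExpansion {X : Type*} {F G : X → ℝ} {R : ℝ × X → ℝ} (hρs : 0 < ρs) (w : X)
    (hR : ∃ K, ∀ ρ ∈ Set.Ioo 0 ρs, |R (ρ, w)| ≤ K) :
    Tendsto (fun ρ => cubicExpansion F G R (ρ, w)) (𝓝[>] 0) (𝓝 (F w)) := by
  have h3 := tendsto_pow_mul_zero hρs (k := 0) (j := 3) (q := fun ρ => R (ρ, w)) (by norm_num)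
    (by simpa using hR)
  have h2 := (tendsto_pow_nhdsGT_zero (k := 2) (by norm_num)).mul_const (G w)
  simpa [cubicExpansion] using (tendsto_const_nhds.add h2).add h3

variable {ι : Type*} [Fintype ι] [DecidableEq ι]

/-- The equation satisfied by the second coefficient of the Fefferman-Graham expansion of an
Einstein metric. -/
theorem ricciCoord_boundary_of_einstein (f : ι → W) (hρs : 0 < ρs) (hΩ : IsOpen Ω) {w : W}
    (hw : w ∈ Ω) {gm gs : W → Matrix ι ι ℝ} {r : ℝ × W → Matrix ι ι ℝ}
    (hgm : ∀ a b, ContDiffOn ℝ ∞ (fun z => gm z a b) Ω)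
    (hgs : ∀ a b, ContDiffOn ℝ ∞ (fun z => gs z a b) Ω)
    (hr : ∀ a b, ContDiffOn ℝ ∞ (fun z => r z a b) (Set.Ioo 0 ρs ×ˢ Ω))
    (hgm_symm : ∀ z ∈ Ω, ∀ a b, gm z a b = gm z b a)
    (hgs_symm : ∀ z ∈ Ω, ∀ a b, gs z a b = gs z b a)
    (hr_symm : ∀ z ∈ Set.Ioo 0 ρs ×ˢ Ω, ∀ a b, r z a b = r z b a)
    (hdet : (gm w).det ≠ 0)
    (r_bound : ∀ a b, ∃ K, ∀ ρ ∈ Set.Ioo 0 ρs, |r (ρ, w) a b| ≤ K)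
    (r_bound₁ : ∀ c a b, ∃ K, ∀ ρ ∈ Set.Ioo 0 ρs,
      |partialDeriv (0, f c) (fun z => r z a b) (ρ, w)| ≤ K)
    (r_bound₂ : ∀ d c a b, ∃ K, ∀ ρ ∈ Set.Ioo 0 ρs,
      |partialDeriv (0, f d) (partialDeriv (0, f c) (fun z => r z a b)) (ρ, w)| ≤ K)
    (r_bound₃ : ∀ a b, ∃ K, ∀ ρ ∈ Set.Ioo 0 ρs,
      |partialDeriv (1, 0) (fun z => r z a b) (ρ, w)| ≤ K * (ρ ^ 1)⁻¹)
    (r_bound₄ : ∀ a b, ∃ K, ∀ ρ ∈ Set.Ioo 0 ρs,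
      |partialDeriv (1, 0) (partialDeriv (1, 0) (fun z => r z a b)) (ρ, w)| ≤ K * (ρ ^ 2)⁻¹)
    {H : ℝ × W → Matrix ι ι ℝ}
    (hH : ∀ z a b, H z a b = gm z.2 a b + z.1 ^ 2 * gs z.2 a b + z.1 ^ 3 * r z a b)
    (a b : ι)
    (hE : ∀ ρ ∈ Set.Ioo 0 ρs, ricciCoord (extendDir f)
      (fun z => blockOption (z.1 ^ 2)⁻¹ ((z.1 ^ 2)⁻¹ • H z)) (some a) (some b) (ρ, w)
        = -(Fintype.card ι : ℝ) * ((ρ ^ 2)⁻¹ * H (ρ, w) a b)) :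
    ricciCoord f gm a b w + ((Fintype.card ι : ℝ) - 2) * gs w a b
      + ((gm w)⁻¹ * gs w).trace * gm w a b = 0 := by
  have hU : IsOpen (Set.Ioo 0 ρs ×ˢ Ω) := isOpen_Ioo.prod hΩ
  have hHe : ∀ a b, (fun z => H z a b)
      = cubicExpansion (fun z => gm z a b) (fun z => gs z a b) (fun z => r z a b) :=
    fun a b => funext fun z => hH z a b
  have hHs : ∀ a b, ContDiffOn ℝ ∞ (fun z => H z a b) (Set.Ioo 0 ρs ×ˢ Ω) := fun a b => by
    rw [hHe]
    exact contDiffOn_cubicExpansion (hgm a b) (hgs a b) (hr a b)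
  have hH1 : ∀ c a b, ∀ z ∈ Set.Ioo 0 ρs ×ˢ Ω, partialDeriv (0, f c) (fun z => H z a b) z
      = cubicExpansion (partialDeriv (f c) fun z => gm z a b) (partialDeriv (f c) fun z => gs z a b)
        (partialDeriv (0, f c) fun z => r z a b) z := fun c a b z hz => by
    rw [hHe, partialDeriv_cubicExpansion hΩ (hgm a b) (hgs a b) (hr a b) _ hz]
    simp
  have hH2 : ∀ d c a b, ∀ z ∈ Set.Ioo 0 ρs ×ˢ Ω,
      partialDeriv (0, f d) (partialDeriv (0, f c) (fun z => H z a b)) z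
      = cubicExpansion (partialDeriv (f d) (partialDeriv (f c) fun z => gm z a b))
        (partialDeriv (f d) (partialDeriv (f c) fun z => gs z a b))
        (partialDeriv (0, f d) (partialDeriv (0, f c) fun z => r z a b)) z := by
    intro d c a b z hz
    rw [partialDeriv_congr _ hU (hH1 c a b) hz,
      partialDeriv_cubicExpansion hΩ (contDiffOn_partialDeriv _ hΩ (hgm a b))
        (contDiffOn_partialDeriv _ hΩ (hgs a b)) (contDiffOn_partialDeriv _ hU (hr a b)) _ hz]
    simp
  have hD1 : ∀ a b, ∀ z ∈ Set.Ioo 0 ρs ×ˢ Ω, partialDeriv (1, 0) (fun z => H z a b) z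
      = 2 * z.1 * gs z.2 a b + 3 * z.1 ^ 2 * r z a b
        + z.1 ^ 3 * partialDeriv (1, 0) (fun z => r z a b) z := fun a b z hz => by
    rw [hHe, partialDeriv_cubicExpansion hΩ (hgm a b) (hgs a b) (hr a b) _ hz]
    simp [cubicExpansion, partialDeriv]
    ring
  have hD2 : ∀ a b, ∀ z ∈ Set.Ioo 0 ρs ×ˢ Ω,
      partialDeriv (1, 0) (partialDeriv (1, 0) (fun z => H z a b)) z
      = 2 * gs z.2 a b + 6 * z.1 * r z a b
        + 6 * z.1 ^ 2 * partialDeriv (1, 0) (fun z => r z a b) z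
        + z.1 ^ 3 * partialDeriv (1, 0) (partialDeriv (1, 0) (fun z => r z a b)) z := by
    intro a b z hz
    have hgs' := differentiableAt_of_contDiffOn hΩ (hgs a b) hz.2
    have hgs2 : DifferentiableAt ℝ (fun z : ℝ × W => gs z.2 a b) z :=
      hgs'.comp z differentiableAt_snd
    have hr' := differentiableAt_of_contDiffOn hU (hr a b) hz
    have hr1 := differentiableAt_of_contDiffOn hU
      (contDiffOn_partialDeriv (1, 0) hU (hr a b)) hz
    have hp : ∀ k : ℕ, DifferentiableAt ℝ (fun z : ℝ × W => z.1 ^ k) z := fun k => by fun_prop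
    have hp1 : DifferentiableAt ℝ (fun z : ℝ × W => 2 * z.1) z := by fun_prop
    have hp2 : DifferentiableAt ℝ (fun z : ℝ × W => 3 * z.1 ^ 2) z := by fun_prop
    have e1 : partialDeriv (1, 0) (fun z : ℝ × W => 2 * z.1) z = 2 := by
      rw [partialDeriv_comp_fst (F := fun r => 2 * r) (by fun_prop)]
      simp
    have e2 : partialDeriv (1, 0) (fun z : ℝ × W => 3 * z.1 ^ 2) z = 6 * z.1 := by
      rw [partialDeriv_const_mul _ _ (hp 2), partialDeriv_fst_pow]
      norm_num
      ring
    have e3 : partialDeriv (1, 0) (fun z : ℝ × W => gs z.2 a b) z = 0 := by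
      rw [partialDeriv_comp_snd (F := fun w => gs w a b) hgs']
      simp [partialDeriv]
    rw [partialDeriv_congr _ hU (hD1 a b) hz,
      partialDeriv_add _ ((hp1.fun_mul hgs2).fun_add (hp2.fun_mul hr')) ((hp 3).fun_mul hr1),
      partialDeriv_add _ (hp1.fun_mul hgs2) (hp2.fun_mul hr'), partialDeriv_mul _ hp1 hgs2,
      partialDeriv_mul _ hp2 hr', partialDeriv_mul _ (hp 3) hr1, e1, e2, e3, partialDeriv_fst_pow]
    norm_num
    ring
  have hmem : ∀ᶠ ρ in 𝓝[>] (0 : ℝ), (ρ, w) ∈ Set.Ioo 0 ρs ×ˢ Ω := by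
    filter_upwards [Ioo_mem_nhdsGT hρs] with ρ hρ using ⟨hρ, hw⟩
  have lH' : ∀ a b, Tendsto (fun ρ => H (ρ, w) a b) (𝓝[>] 0) (𝓝 (gm w a b)) := fun a b => by
    have := tendsto_cubicExpansion (F := fun z => gm z a b) (G := fun z => gs z a b)
      (R := fun z => r z a b) hρs w (r_bound a b)
    rwa [← hHe] at this
  have lH : Tendsto (fun ρ => H (ρ, w)) (𝓝[>] 0) (𝓝 (gm w)) :=
    tendsto_pi_nhds.2 fun a => tendsto_pi_nhds.2 fun b => lH' a b
  have lI := tendsto_matrix_inv lH hdet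
  have lH1 : ∀ c a b, Tendsto (fun ρ => partialDeriv (0, f c) (fun z => H z a b) (ρ, w)) (𝓝[>] 0)
      (𝓝 (partialDeriv (f c) (fun z => gm z a b) w)) := fun c a b => by
    refine (tendsto_cubicExpansion (G := partialDeriv (f c) fun z => gs z a b)
      hρs w (r_bound₁ c a b)).congr' ?_
    filter_upwards [hmem] with ρ hρ using (hH1 c a b _ hρ).symm
  have lH2 : ∀ d c a b, Tendsto (fun ρ => partialDeriv (0, f d)
      (partialDeriv (0, f c) (fun z => H z a b)) (ρ, w)) (𝓝[>] 0)
      (𝓝 (partialDeriv (f d) (partialDeriv (f c) (fun z => gm z a b)) w)) := fun d c a b => by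
    refine (tendsto_cubicExpansion
      (G := partialDeriv (f d) (partialDeriv (f c) fun z => gs z a b)) hρs w
      (r_bound₂ d c a b)).congr' ?_
    filter_upwards [hmem] with ρ hρ using (hH2 d c a b _ hρ).symm
  have t1 : ∀ a b, Tendsto (fun ρ : ℝ => ρ ^ 1 * r (ρ, w) a b) (𝓝[>] 0) (𝓝 0) := fun a b =>
    tendsto_pow_mul_zero hρs (k := 0) (by norm_num) (by simpa using r_bound a b)
  have t2 : ∀ a b, Tendsto (fun ρ : ℝ => ρ ^ 2 * partialDeriv (1, 0) (fun z => r z a b) (ρ, w))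
      (𝓝[>] 0) (𝓝 0) := fun a b =>
    tendsto_pow_mul_zero hρs (k := 1) (by norm_num) (r_bound₃ a b)
  have t3 : ∀ a b, Tendsto (fun ρ : ℝ => ρ ^ 3 *
      partialDeriv (1, 0) (partialDeriv (1, 0) (fun z => r z a b)) (ρ, w)) (𝓝[>] 0) (𝓝 0) :=
    fun a b => tendsto_pow_mul_zero hρs (k := 2) (by norm_num) (r_bound₄ a b)
  have lD2 : ∀ a b, Tendsto (fun ρ => partialDeriv (1, 0)
      (partialDeriv (1, 0) (fun z => H z a b)) (ρ, w)) (𝓝[>] 0) (𝓝 (2 * gs w a b)) := by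
    intro a b
    have h := (((tendsto_const_nhds (x := 2 * gs w a b)).add ((t1 a b).const_mul 6)).add
      ((t2 a b).const_mul 6)).add (t3 a b)
    simp only [mul_zero, add_zero] at h
    refine h.congr' ?_
    filter_upwards [hmem] with ρ hρ
    rw [hD2 a b _ hρ]
    ring
  set D : ℝ → Matrix ι ι ℝ := fun ρ =>
    Matrix.of fun a b => partialDeriv (1, 0) (fun z => H z a b) (ρ, w) with hDdef
  -- The absence of a linear term in `H` gives `∂_ρ H = 2 ρ gs + o(ρ)`, so the `ρ⁻¹` terms converge
  -- while terms quadratic in `∂_ρ H` disappear.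
  have lDρ : Tendsto (fun ρ => ρ⁻¹ • D ρ) (𝓝[>] 0) (𝓝 ((2 : ℝ) • gs w)) := by
    refine tendsto_pi_nhds.2 fun a => tendsto_pi_nhds.2 fun b => ?_
    have h := ((tendsto_const_nhds (x := 2 * gs w a b)).add ((t1 a b).const_mul 3)).add (t2 a b)
    simp only [mul_zero, add_zero] at h
    refine h.congr' ?_
    filter_upwards [hmem] with ρ hρ
    have h0 : ρ ≠ 0 := hρ.1.1.ne'
    simp only [hDdef, Matrix.smul_apply, Matrix.of_apply, smul_eq_mul, hD1 a b _ hρ]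
    field_simp
  have lD : Tendsto D (𝓝[>] 0) (𝓝 0) := by
    have h := (tendsto_pow_nhdsGT_zero (k := 1) (by norm_num)).smul lDρ
    rw [zero_smul] at h
    refine h.congr' ?_
    filter_upwards [hmem] with ρ hρ
    have h0 : ρ ≠ 0 := hρ.1.1.ne'
    rw [pow_one, smul_smul, mul_inv_cancel₀ h0, one_smul]
  have lm : ∀ {M : ℝ → Matrix ι ι ℝ} {M₀ : Matrix ι ι ℝ} (a b : ι),
      Tendsto M (𝓝[>] 0) (𝓝 M₀) → Tendsto (fun ρ => M ρ a b) (𝓝[>] 0) (𝓝 (M₀ a b)) :=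
    fun a b h => tendsto_pi_nhds.1 (tendsto_pi_nhds.1 h a) b
  have ltr : ∀ {M : ℝ → Matrix ι ι ℝ} {M₀ : Matrix ι ι ℝ},
      Tendsto M (𝓝[>] 0) (𝓝 M₀) → Tendsto (fun ρ => (M ρ).trace) (𝓝[>] 0) (𝓝 M₀.trace) :=
    fun h => tendsto_finsetSum _ fun i _ => lm i i h
  have lR := tendsto_ricciAlg lI lH1 lH2 a b
  -- Invertibility is assumed only for `gm` at `w`. It persists on a neighbourhood of `w`, and for
  -- `H` at `(ρ, w)` with `ρ` small.
  have hdetU : IsOpen (Set.Ioo 0 ρs ×ˢ Ω ∩ {z | (H z).det ≠ 0}) :=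
    (contDiffOn_det hHs).continuousOn.isOpen_inter_preimage hU isOpen_ne
  have hdetU' : IsOpen (Ω ∩ {z | (gm z).det ≠ 0}) :=
    (contDiffOn_det hgm).continuousOn.isOpen_inter_preimage hΩ isOpen_ne
  have hdetE : ∀ᶠ ρ in 𝓝[>] (0 : ℝ), (H (ρ, w)).det ≠ 0 :=
    (((continuous_id.matrix_det (n := ι) (R := ℝ)).tendsto _).comp lH).eventually_ne hdet
  have lim := ((((lR.sub ((lD2 a b).const_mul (1 / 2))).add
    ((lm a b lDρ).const_mul (((Fintype.card ι : ℝ) - 1) / 2))).add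
    (((ltr (lI.mul lDρ)).const_mul (1 / 2)).mul (lH' a b))).add
    ((lm a b ((lD.mul lI).mul lD)).const_mul (1 / 2))).sub
    (((ltr (lI.mul lD)).const_mul (1 / 4)).mul (lm a b lD))
  -- For small `ρ` the Einstein equation makes the converging expression vanish identically. In its
  -- limit, `-½ · 2 gs + ½ (N - 1) · 2 gs` produces the coefficient `N - 2` of `gs`, with `N = card
  -- ι`.
  have lim0 := tendsto_nhds_unique (lim.congr' (f₂ := fun _ => (0 : ℝ)) (by
    filter_upwards [hmem, hdetE] with ρ hρ hρd
    have hfg := ricciCoord_feffermanGraham f hdetU (fun z hz => hz.1.1.1)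
      (fun a b => (hHs a b).mono Set.inter_subset_left) (fun z hz => hz.2)
      (fun z hz a b => by
        rw [hH, hH, hgm_symm _ hz.1.2, hgs_symm _ hz.1.2, hr_symm _ hz.1]) ⟨hρ, hρd⟩ a b
      (D := D ρ) (D₂ := Matrix.of fun a b =>
        partialDeriv (1, 0) (partialDeriv (1, 0) (fun z => H z a b)) (ρ, w))
      (fun a b => rfl) rfl
    rw [hE ρ hρ.1, ricciCoord_eq_ricciAlg _ hdetU
      (fun a b => (hHs a b).mono Set.inter_subset_left) (fun z hz => hz.2) ⟨hρ, hρd⟩] at hfg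
    simp only [Matrix.mul_smul, Matrix.trace_smul, Matrix.smul_apply, smul_eq_mul]
    rw [neg_mul, neg_add_cancel] at hfg
    exact hfg.symm)) tendsto_const_nhds
  rw [← ricciCoord_eq_ricciAlg f hdetU' (fun a b => (hgm a b).mono Set.inter_subset_left)
    (fun z hz => hz.2) ⟨hw, hdet⟩] at lim0
  simp only [Matrix.mul_smul, Matrix.trace_smul, Matrix.smul_apply, smul_eq_mul, Matrix.zero_mul,
    Matrix.mul_zero, Matrix.zero_apply, Matrix.trace_zero] at lim0
  linarith

end Limit

/-! ### Changes of chart, frames and tensor components. -/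

section Charts

variable {n : ℕ} {S : Type*} [TopologicalSpace S] {φ χ : OpenPartialHomeomorph S (E n)}

/-- The domain of the coordinate change from `χ` to `φ`. -/
def transitionDomain (χ φ : OpenPartialHomeomorph S (E n)) : Set (E n) :=
  χ.target ∩ χ.symm ⁻¹' φ.source

/-- The coordinate change from `χ` to `φ`. -/
def transition (χ φ : OpenPartialHomeomorph S (E n)) (z : E n) : E n := φ (χ.symm z)

theorem isOpen_transitionDomain (χ φ : OpenPartialHomeomorph S (E n)) :
    IsOpen (transitionDomain χ φ) := χ.symm.isOpen_inter_preimage φ.open_source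

theorem mapsTo_transition : Set.MapsTo (transition χ φ) (transitionDomain χ φ) φ.target :=
  fun _ hz => φ.map_source hz.2

variable [ChartedSpace (E n) S]

theorem mdifferentiable_of_mem_charts (hφ : φ ∈ charts n S) :
    φ.MDifferentiable 𝓘(ℝ, E n) 𝓘(ℝ, E n) :=
  ⟨(contMDiffOn_of_mem_maximalAtlas hφ).mdifferentiableOn (by simp),
    (contMDiffOn_symm_of_mem_maximalAtlas hφ).mdifferentiableOn (by simp)⟩

/-- The differential of `φ⁻¹`, with the tangent spaces of `S` identified with the model space. -/
def symmDeriv (φ : OpenPartialHomeomorph S (E n)) (z : E n) : E n →L[ℝ] E n :=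
  mfderiv 𝓘(ℝ, E n) 𝓘(ℝ, E n) φ.symm z

/-- The differential of `φ`, with the tangent spaces of `S` identified with the model space. -/
def chartDeriv (φ : OpenPartialHomeomorph S (E n)) (x : S) : E n →L[ℝ] E n :=
  mfderiv 𝓘(ℝ, E n) 𝓘(ℝ, E n) φ x

theorem symmDeriv_comp_chartDeriv [IsManifold 𝓘(ℝ, E n) ∞ S]
    (hφ : φ ∈ charts n S) {x : S} (hx : x ∈ φ.source) :
    (symmDeriv φ (φ x)).comp (chartDeriv φ x) = ContinuousLinearMap.id ℝ (E n) :=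
  (mdifferentiable_of_mem_charts hφ).symm_comp_deriv hx

theorem chartDeriv_comp_symmDeriv [IsManifold 𝓘(ℝ, E n) ∞ S]
    (hφ : φ ∈ charts n S) {x : S} (hx : x ∈ φ.source) :
    (chartDeriv φ x).comp (symmDeriv φ (φ x)) = ContinuousLinearMap.id ℝ (E n) := by
  have h := (mdifferentiable_of_mem_charts hφ).comp_symm_deriv (φ.map_source hx)
  rw [φ.left_inv hx] at h
  exact h

theorem contDiffOn_transition (hφ : φ ∈ charts n S) (hχ : χ ∈ charts n S) :
    ContDiffOn ℝ ∞ (transition χ φ) (transitionDomain χ φ) := by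
  rw [← contMDiffOn_iff_contDiffOn]
  exact (contMDiffOn_of_mem_maximalAtlas hφ).comp
    ((contMDiffOn_symm_of_mem_maximalAtlas hχ).mono fun z hz => hz.1) fun z hz => hz.2

theorem symmDeriv_transition (hφ : φ ∈ charts n S) (hχ : χ ∈ charts n S) {z : E n}
    (hz : z ∈ transitionDomain χ φ) :
    symmDeriv χ z = (symmDeriv φ (transition χ φ z)).comp (fderiv ℝ (transition χ φ) z) := by
  have hopen := isOpen_transitionDomain χ φ
  have heq : χ.symm =ᶠ[nhds z] φ.symm ∘ transition χ φ := by
    filter_upwards [hopen.mem_nhds hz] with w hw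
    exact (φ.left_inv hw.2).symm
  have h1 : MDifferentiableAt 𝓘(ℝ, E n) 𝓘(ℝ, E n) (transition χ φ) z :=
    (((contDiffOn_transition hφ hχ).contDiffAt (hopen.mem_nhds hz)).differentiableAt
      (by simp)).mdifferentiableAt
  have h2 : MDifferentiableAt 𝓘(ℝ, E n) 𝓘(ℝ, E n) φ.symm (transition χ φ z) :=
    (mdifferentiable_of_mem_charts hφ).mdifferentiableAt_symm (mapsTo_transition hz)
  unfold symmDeriv
  rw [← mfderiv_eq_fderiv]
  exact heq.mfderiv_eq.trans (mfderiv_comp z h2 h1)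

theorem sum_smul_dirS (v : E n) : ∑ A, v A • dirS n A = v := by
  ext B
  simp [dirS, Pi.single_apply]

theorem dirS_apply (A B : Fin (n - 1)) : dirS n A B = (1 : Matrix _ _ ℝ) A B := by
  simp [dirS, Matrix.one_apply, eq_comm]

/-- The frame `∂_t, ∂_{x^A}`, with the tangent spaces of `S` identified with the model space. -/
def modelFrame (φ : OpenPartialHomeomorph S (E n)) (z : E n) (a : IdxI n) : ℝ × E n :=
  frameI φ z a

/-- The Jacobian matrix of the coordinate change from `χ` to `φ` on `I`. -/
def transitionJacobian (χ φ : OpenPartialHomeomorph S (E n)) (z : E n) :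
    Matrix (IdxI n) (IdxI n) ℝ :=
  blockOption 1 (Matrix.of fun A B => (fderiv ℝ (transition χ φ) z (dirS n A)) B)

theorem contDiffOn_transitionJacobian (hφ : φ ∈ charts n S) (hχ : χ ∈ charts n S) (a c : IdxI n) :
    ContDiffOn ℝ ∞ (fun z => transitionJacobian χ φ z a c) (transitionDomain χ φ) := by
  rcases a with _ | A <;> rcases c with _ | B
  · exact contDiffOn_const
  · exact contDiffOn_const
  · exact contDiffOn_const
  · have h := ((contDiffOn_transition hφ hχ).fderiv_of_isOpen (isOpen_transitionDomain χ φ)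
      (m := ∞) (by simp)).clm_apply (contDiffOn_const (c := dirS n A))
    exact (EuclideanSpace.proj (𝕜 := ℝ) B).contDiff.comp_contDiffOn h

theorem modelFrame_transition (hφ : φ ∈ charts n S) (hχ : χ ∈ charts n S) {z : E n}
    (hz : z ∈ transitionDomain χ φ) (a : IdxI n) :
    modelFrame χ z a
      = ∑ c, transitionJacobian χ φ z a c • modelFrame φ (transition χ φ z) c := by
  rw [Fintype.sum_option]
  rcases a with _ | A
  · have h0 : ∀ w (ψ : OpenPartialHomeomorph S (E n)), modelFrame ψ w none = (1, 0) :=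
      fun _ _ => rfl
    simp [transitionJacobian, h0]
  · have h1 : ∀ w (ψ : OpenPartialHomeomorph S (E n)) B,
        modelFrame ψ w (some B) = (0, symmDeriv ψ w (dirS n B)) := fun _ _ _ => rfl
    simp only [transitionJacobian, h1, blockOption_some_none, zero_smul, zero_add,
      blockOption_some_some, Matrix.of_apply, Prod.smul_mk, smul_zero]
    rw [symmDeriv_transition hφ hχ hz, ContinuousLinearMap.comp_apply]
    conv_lhs => rw [← sum_smul_dirS (fderiv ℝ (transition χ φ) z (dirS n A))]
    rw [map_sum]
    simp only [map_smul]
    ext1 <;> simp [Prod.fst_sum, Prod.snd_sum]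

/-- The change of coordinates for tensors on the level sets of `ρ`. -/
theorem compHTensorM_transition (hφ : φ ∈ charts n S) (hχ : χ ∈ charts n S) (h : HTensorM n S)
    {y : Coords n} (hy : y.2.2 ∈ transitionDomain χ φ) (a b : IdxI n) :
    compHTensorM χ h y a b = ∑ c, ∑ d, transitionJacobian χ φ y.2.2 a c *
      (transitionJacobian χ φ y.2.2 b d *
        compHTensorM φ h (y.1, y.2.1, transition χ φ y.2.2) c d) := by
  let h' : S → LinearMap.BilinForm ℝ (ℝ × E n) := h y.1 y.2.1
  have e1 : compHTensorM χ h y a b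
      = h' (χ.symm y.2.2) (modelFrame χ y.2.2 a) (modelFrame χ y.2.2 b) := rfl
  have e2 : ∀ c d, compHTensorM φ h (y.1, y.2.1, transition χ φ y.2.2) c d
      = h' (χ.symm y.2.2) (modelFrame φ (transition χ φ y.2.2) c)
        (modelFrame φ (transition χ φ y.2.2) d) := fun c d => by
    have : φ.symm (transition χ φ y.2.2) = χ.symm y.2.2 := φ.left_inv hy.2
    rw [← this]
    rfl
  rw [e1, modelFrame_transition hφ hχ hy, modelFrame_transition hφ hχ hy]
  simp only [e2, map_sum, LinearMap.sum_apply, map_smul, LinearMap.smul_apply, smul_eq_mul,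
    Finset.mul_sum]
  rw [Finset.sum_comm]
  refine Finset.sum_congr rfl fun c _ => Finset.sum_congr rfl fun d _ => ?_
  ring

/-- The components of a tangent vector of `I`. -/
def compI (φ : OpenPartialHomeomorph S (E n)) (x : S) (X : ℝ × TS n x) (a : IdxI n) : ℝ :=
  compM φ x (0, X) (some a)

/-- The frame of the coordinate system `φ`, as vectors at the point `x`. -/
def frameAt (φ : OpenPartialHomeomorph S (E n)) (x : S) (a : IdxI n) : ℝ × TS n x :=
  modelFrame φ (φ x) a

theorem sum_compI_smul_frameAt [IsManifold 𝓘(ℝ, E n) ∞ S]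
    (hφ : φ ∈ charts n S) {x : S} (hx : x ∈ φ.source)
    (X : ℝ × TS n x) : ∑ a, compI φ x X a • frameAt φ x a = X := by
  have key : ∀ v : E n, ∑ A, (chartDeriv φ x v) A • symmDeriv φ (φ x) (dirS n A) = v := by
    intro v
    have h := DFunLike.congr_fun (symmDeriv_comp_chartDeriv hφ hx) v
    rw [ContinuousLinearMap.comp_apply, ← sum_smul_dirS (chartDeriv φ x v), map_sum] at h
    simp only [map_smul] at h
    exact h
  have model : ∀ X : ℝ × E n, ∑ a, compI φ x X a • modelFrame φ (φ x) a = X := by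
    intro X
    have h0 : modelFrame φ (φ x) none = (1, 0) := rfl
    have h1 : ∀ B, modelFrame φ (φ x) (some B) = (0, symmDeriv φ (φ x) (dirS n B)) :=
      fun _ => rfl
    have c0 : compI φ x X none = X.1 := rfl
    have c1 : ∀ A, compI φ x X (some A) = (chartDeriv φ x X.2) A := fun _ => rfl
    rw [Fintype.sum_option, c0, h0]
    simp only [c1, h1]
    ext1
    · simp [Prod.fst_sum]
    · simp [Prod.snd_sum, key]
  exact model X

theorem compI_frameAt [IsManifold 𝓘(ℝ, E n) ∞ S]
    (hφ : φ ∈ charts n S) {x : S} (hx : x ∈ φ.source) (a b : IdxI n) :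
    compI φ x (frameAt φ x a) b = (1 : Matrix (IdxI n) (IdxI n) ℝ) a b := by
  have key : ∀ v : E n, chartDeriv φ x (symmDeriv φ (φ x) v) = v := fun v =>
    DFunLike.congr_fun (chartDeriv_comp_symmDeriv hφ hx) v
  rcases a with _ | A <;> rcases b with _ | B
  · rfl
  · have : compI φ x (frameAt φ x none) (some B) = (chartDeriv φ x 0) B := rfl
    rw [this, map_zero]
    simp
  · simp
    rfl
  · have : compI φ x (frameAt φ x (some A)) (some B)
        = (chartDeriv φ x (symmDeriv φ (φ x) (dirS n A))) B := rfl
    rw [this, key, dirS_apply]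
    simp [Matrix.one_apply]

theorem compHTensorM_eq_frameAt {x : S} (hx : x ∈ φ.source) (h : HTensorM n S) (ρ t : ℝ)
    (a b : IdxI n) :
    compHTensorM φ h (ρ, t, φ x) a b = h ρ t x (frameAt φ x a) (frameAt φ x b) := by
  let h' : S → LinearMap.BilinForm ℝ (ℝ × E n) := h ρ t
  have : h' (φ.symm (φ x)) (modelFrame φ (φ x) a) (modelFrame φ (φ x) b)
      = h' x (modelFrame φ (φ x) a) (modelFrame φ (φ x) b) := by rw [φ.left_inv hx]
  exact this

/-- Turns an identity between component matrices in one chart back into an identity between tensors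
at a point. -/
theorem bilin_eq_sum_compI [IsManifold 𝓘(ℝ, E n) ∞ S]
    (hφ : φ ∈ charts n S) {x : S} (hx : x ∈ φ.source)
    (B : LinearMap.BilinForm ℝ (ℝ × TS n x)) (X Y : ℝ × TS n x) :
    B X Y = ∑ a, ∑ b, B (frameAt φ x a) (frameAt φ x b) * compI φ x X a * compI φ x Y b := by
  conv_lhs => rw [← sum_compI_smul_frameAt hφ hx X, ← sum_compI_smul_frameAt hφ hx Y]
  simp only [map_sum, LinearMap.sum_apply, map_smul, LinearMap.smul_apply, smul_eq_mul,
    Finset.mul_sum]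
  rw [Finset.sum_comm]
  refine Finset.sum_congr rfl fun c _ => Finset.sum_congr rfl fun d _ => ?_
  ring

end Charts

/-! ### Transport of remainder bounds between charts. -/

section Pullback

variable {n : ℕ}

theorem isOpen_coordRegion (ρs T : ℝ) {Ω : Set (E n)} (hΩ : IsOpen Ω) :
    IsOpen (Set.Ioo 0 ρs ×ˢ Set.Ioo 0 (Real.pi * T) ×ˢ Ω) :=
  isOpen_Ioo.prod (isOpen_Ioo.prod hΩ)

theorem contDiffOn_iterPartial {V : Type*} [NormedAddCommGroup V] [NormedSpace ℝ V] {U : Set V}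
    (hU : IsOpen U) {F : V → ℝ} (hF : ContDiffOn ℝ ∞ F U) (l : List V) :
    ContDiffOn ℝ ∞ (iterPartial l F) U := by
  induction l with
  | nil => exact hF
  | cons v l ih => exact contDiffOn_partialDeriv v hU ih

/-- A change `(ρ, t, z) ↦ (ρ, t, ψ z)` of the coordinates on `S`. -/
def liftCoords (ψ : E n → E n) (y : Coords n) : Coords n := (y.1, y.2.1, ψ y.2.2)

variable {S : Type*} [TopologicalSpace S]

/-- The functions generated, over the smooth functions on `Ω`, by the pullbacks under `ψ` of the
derivatives `∂_ρ^k ∂_{a₁} ⋯ ∂_{a_m} u` of functions `u = O_φ(1)`. -/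
inductive PullbackClass (ρs T : ℝ) (φ : OpenPartialHomeomorph S (E n)) (ψ : E n → E n)
    (Ω : Set (E n)) (k : ℕ) : (Coords n → ℝ) → Prop
  | base (u : Coords n → ℝ) (hu : IsBigOOne ρs T φ u) (l : List (IdxI n)) :
      PullbackClass ρs T φ ψ Ω k fun y =>
        iterPartial (List.replicate k (dirM n none) ++ l.map fun a => dirM n (some a)) u
          (liftCoords ψ y)
  | zero : PullbackClass ρs T φ ψ Ω k fun _ => 0
  | add (f g : Coords n → ℝ) (hf : PullbackClass ρs T φ ψ Ω k f)
      (hg : PullbackClass ρs T φ ψ Ω k g) : PullbackClass ρs T φ ψ Ω k fun y => f y + g y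
  | mul (J : E n → ℝ) (hJ : ContDiffOn ℝ ∞ J Ω) (f : Coords n → ℝ)
      (hf : PullbackClass ρs T φ ψ Ω k f) : PullbackClass ρs T φ ψ Ω k fun y => J y.2.2 * f y
  | congr (f g : Coords n → ℝ) (hf : PullbackClass ρs T φ ψ Ω k f)
      (hfg : Set.EqOn g f (Set.Ioo 0 ρs ×ˢ Set.Ioo 0 (Real.pi * T) ×ˢ Ω)) :
      PullbackClass ρs T φ ψ Ω k g

namespace PullbackClass

variable {ρs T : ℝ} {φ : OpenPartialHomeomorph S (E n)} {ψ : E n → E n} {Ω : Set (E n)} {k : ℕ}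
  {f : Coords n → ℝ}

theorem sum {κ : Type*} (s : Finset κ) {F : κ → Coords n → ℝ}
    (hF : ∀ i ∈ s, PullbackClass ρs T φ ψ Ω k (F i)) :
    PullbackClass ρs T φ ψ Ω k fun y => ∑ i ∈ s, F i y := by
  classical
  induction s using Finset.induction_on with
  | empty => simpa using PullbackClass.zero
  | insert i s hi ih =>
    simp only [Finset.sum_insert hi]
    exact .add _ _ (hF i (Finset.mem_insert_self i s))
      (ih fun j hj => hF j (Finset.mem_insert_of_mem hj))

/-- The point `(t, z)` is fixed and the constant may depend on it: the coefficients `J` are smooth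
on `Ω` but need not be bounded there. -/
theorem bound (hψ : Set.MapsTo ψ Ω φ.target) (hf : PullbackClass ρs T φ ψ Ω k f) {t : ℝ}
    (ht : t ∈ Set.Ioo 0 (Real.pi * T)) {z : E n} (hz : z ∈ Ω) :
    ∃ K, ∀ ρ ∈ Set.Ioo 0 ρs, |f (ρ, t, z)| ≤ K * (ρ ^ k)⁻¹ := by
  induction hf with
  | base u hu l =>
    obtain ⟨K, hK⟩ := hu.2 k l
    exact ⟨K, fun ρ hρ => hK (ρ, t, ψ z) ⟨hρ, ht, hψ hz⟩⟩
  | zero => exact ⟨0, fun ρ _ => by simp⟩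
  | add f g _ _ ihf ihg =>
    obtain ⟨K, hK⟩ := ihf
    obtain ⟨K', hK'⟩ := ihg
    refine ⟨K + K', fun ρ hρ => (abs_add_le _ _).trans ?_⟩
    rw [add_mul]
    exact add_le_add (hK ρ hρ) (hK' ρ hρ)
  | mul J hJ f _ ih =>
    obtain ⟨K, hK⟩ := ih
    refine ⟨|J z| * K, fun ρ hρ => ?_⟩
    rw [abs_mul, mul_assoc]
    exact mul_le_mul_of_nonneg_left (hK ρ hρ) (abs_nonneg _)
  | congr f g _ hfg ih =>
    obtain ⟨K, hK⟩ := ih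
    exact ⟨K, fun ρ hρ => by rw [hfg ⟨hρ, ht, hz⟩]; exact hK ρ hρ⟩

theorem mapsTo_liftCoords (hψ : Set.MapsTo ψ Ω φ.target) :
    Set.MapsTo (liftCoords ψ) (Set.Ioo 0 ρs ×ˢ Set.Ioo 0 (Real.pi * T) ×ˢ Ω)
      (coordDomain ρs T φ) :=
  fun _ hy => ⟨hy.1, hy.2.1, hψ hy.2.2⟩

theorem isOpen_coordDomain (ρs T : ℝ) (φ : OpenPartialHomeomorph S (E n)) :
    IsOpen (coordDomain ρs T φ) := isOpen_coordRegion ρs T φ.open_target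

variable (hΩ : IsOpen Ω) (hψ : Set.MapsTo ψ Ω φ.target) (hψs : ContDiffOn ℝ ∞ ψ Ω)

include hψs

theorem contDiffOn_liftCoords :
    ContDiffOn ℝ ∞ (liftCoords ψ) (Set.Ioo 0 ρs ×ˢ Set.Ioo 0 (Real.pi * T) ×ˢ Ω) :=
  contDiff_fst.contDiffOn.prodMk ((contDiff_fst.comp contDiff_snd).contDiffOn.prodMk
    (hψs.comp (contDiff_snd.comp contDiff_snd).contDiffOn fun _ hy => hy.2.2))

include hψ

theorem contDiffOn (hf : PullbackClass ρs T φ ψ Ω k f) :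
    ContDiffOn ℝ ∞ f (Set.Ioo 0 ρs ×ˢ Set.Ioo 0 (Real.pi * T) ×ˢ Ω) := by
  induction hf with
  | base u hu l =>
    exact (contDiffOn_iterPartial (isOpen_coordDomain ρs T φ) hu.1 _).comp
      (contDiffOn_liftCoords hψs) (mapsTo_liftCoords hψ)
  | zero => exact contDiffOn_const
  | add f g _ _ ihf ihg => exact ihf.add ihg
  | mul J hJ f _ ih =>
    exact (hJ.comp (contDiff_snd.comp contDiff_snd).contDiffOn fun _ hy => hy.2.2).mul ih
  | congr f g _ hfg ih => exact ih.congr hfg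

include hΩ

theorem partialDeriv_comp_liftCoords {F : Coords n → ℝ}
    (hF : ContDiffOn ℝ ∞ F (coordDomain ρs T φ)) (v : Coords n) {y : Coords n}
    (hy : y ∈ Set.Ioo 0 ρs ×ˢ Set.Ioo 0 (Real.pi * T) ×ˢ Ω) :
    partialDeriv v (fun y => F (liftCoords ψ y)) y
      = partialDeriv (v.1, v.2.1, fderiv ℝ ψ y.2.2 v.2.2) F (liftCoords ψ y) := by
  have hF' := (differentiableAt_of_contDiffOn (isOpen_coordDomain ρs T φ) hF
    (mapsTo_liftCoords hψ hy)).hasFDerivAt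
  have hψ' : HasFDerivAt ψ (fderiv ℝ ψ y.2.2) y.2.2 :=
    ((hψs.contDiffAt (hΩ.mem_nhds hy.2.2)).differentiableAt (by simp)).hasFDerivAt
  have hfst : HasFDerivAt (fun y : Coords n => y.1) _ y := hasFDerivAt_fst (𝕜 := ℝ)
  have hsnd : HasFDerivAt (fun y : Coords n => y.2) _ y := hasFDerivAt_snd (𝕜 := ℝ)
  have hthd : HasFDerivAt (fun y : Coords n => ψ y.2.2) _ y :=
    (hψ'.comp y.2 (hasFDerivAt_snd (𝕜 := ℝ))).comp y hsnd
  have hΦ : HasFDerivAt (liftCoords ψ) _ y := hfst.prodMk (hsnd.fst.prodMk hthd)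
  have h : HasFDerivAt (fun y => F (liftCoords ψ y)) _ y := hF'.comp y hΦ
  rw [partialDeriv, h.fderiv]
  rfl

/-- The coordinate change and the coefficients `J` do not involve `ρ`, so `∂_ρ` falls on the bounded
functions alone and costs one power of `ρ⁻¹`. -/
theorem partialDeriv_dirM_none (hf : PullbackClass ρs T φ ψ Ω k f) :
    PullbackClass ρs T φ ψ Ω (k + 1) (partialDeriv (dirM n none) f) := by
  have hU := isOpen_coordRegion ρs T hΩ
  induction hf with
  | base u hu l =>
    refine .congr _ _ (.base u hu l) fun y hy => ?_
    rw [partialDeriv_comp_liftCoords hΩ hψ hψs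
      (contDiffOn_iterPartial (isOpen_coordDomain ρs T φ) hu.1 _) _ hy]
    simp only [dirM, map_zero]
    rfl
  | zero => exact .congr _ _ .zero fun y _ => partialDeriv_const _ _
  | add f g hf hg ihf ihg =>
    exact .congr _ _ (.add _ _ ihf ihg) fun y hy => partialDeriv_add _
      (differentiableAt_of_contDiffOn hU (hf.contDiffOn hψ hψs) hy)
      (differentiableAt_of_contDiffOn hU (hg.contDiffOn hψ hψs) hy)
  | mul J hJ f hf ih =>
    refine .congr _ _ (.mul J hJ _ ih) fun y hy => ?_
    have hJ' := differentiableAt_of_contDiffOn hΩ hJ hy.2.2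
    have hJ2 : DifferentiableAt ℝ (fun w : ℝ × E n => J w.2) y.2 :=
      hJ'.comp y.2 differentiableAt_snd
    have hJ3 : DifferentiableAt ℝ (fun y : Coords n => J y.2.2) y :=
      hJ2.comp y differentiableAt_snd
    rw [partialDeriv_mul _ hJ3 (differentiableAt_of_contDiffOn hU (hf.contDiffOn hψ hψs) hy),
      partialDeriv_comp_snd (F := fun w : ℝ × E n => J w.2) hJ2]
    have h0 : (dirM n none).2 = 0 := rfl
    simp [h0, partialDeriv]
  | congr f g hf hfg ih =>
    exact .congr _ _ ih fun y hy => partialDeriv_congr _ hU hfg hy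

/-- By the chain rule, tangential derivatives only introduce Jacobian coefficients. The restriction
to `k = 0` avoids commuting derivatives: in the definition of `O_φ(1)` the `ρ`-derivatives are
applied last. -/
theorem partialDeriv_dirM_some (hf : PullbackClass ρs T φ ψ Ω 0 f) (a : IdxI n) :
    PullbackClass ρs T φ ψ Ω 0 (partialDeriv (dirM n (some a)) f) := by
  have hU := isOpen_coordRegion ρs T hΩ
  induction hf with
  | base u hu l =>
    have hs := contDiffOn_iterPartial (isOpen_coordDomain ρs T φ) hu.1
      (List.replicate 0 (dirM n none) ++ l.map fun a => dirM n (some a))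
    rcases a with _ | A
    · refine .congr _ _ (.base u hu (none :: l)) fun y hy => ?_
      rw [partialDeriv_comp_liftCoords hΩ hψ hψs hs _ hy]
      simp only [dirM, map_zero]
      rfl
    · have hJ : ∀ B, ContDiffOn ℝ ∞ (fun z => (fderiv ℝ ψ z (dirS n A)) B) Ω := fun B =>
        (EuclideanSpace.proj (𝕜 := ℝ) B).contDiff.comp_contDiffOn
          ((hψs.fderiv_of_isOpen hΩ (m := ∞) (by simp)).clm_apply contDiffOn_const)
      refine .congr _ _ (PullbackClass.sum Finset.univ fun B _ =>
        .mul _ (hJ B) _ (.base u hu (some B :: l))) fun y hy => ?_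
      rw [partialDeriv_comp_liftCoords hΩ hψ hψs hs _ hy]
      -- The pushed-forward direction is expanded in coordinate directions, since the bounds concern
      -- only these.
      have hv : ((0, 0, fderiv ℝ ψ y.2.2 (dirS n A)) : Coords n)
          = ∑ B, (fderiv ℝ ψ y.2.2 (dirS n A)) B • dirM n (some (some B)) := by
        conv_lhs => rw [← sum_smul_dirS (fderiv ℝ ψ y.2.2 (dirS n A))]
        refine Prod.ext ?_ (Prod.ext ?_ ?_) <;> simp [dirM, Prod.fst_sum, Prod.snd_sum]
      simp only [dirM] at hv ⊢
      rw [hv, partialDeriv, map_sum]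
      simp only [map_smul, smul_eq_mul]
      rfl
  | zero => exact .congr _ _ .zero fun y _ => partialDeriv_const _ _
  | add f g hf hg ihf ihg =>
    exact .congr _ _ (.add _ _ ihf ihg) fun y hy => partialDeriv_add _
      (differentiableAt_of_contDiffOn hU (hf.contDiffOn hψ hψs) hy)
      (differentiableAt_of_contDiffOn hU (hg.contDiffOn hψ hψs) hy)
  | mul J hJ f hf ih =>
    refine .congr _ _ (.add _ _ (.mul _
      (contDiffOn_partialDeriv (dirM n (some a)).2.2 hΩ hJ) _ hf) (.mul J hJ _ ih))
      fun y hy => ?_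
    have hJ' := differentiableAt_of_contDiffOn hΩ hJ hy.2.2
    have hJ2 : DifferentiableAt ℝ (fun w : ℝ × E n => J w.2) y.2 :=
      hJ'.comp y.2 differentiableAt_snd
    have hJ3 : DifferentiableAt ℝ (fun y : Coords n => J y.2.2) y :=
      hJ2.comp y differentiableAt_snd
    rw [partialDeriv_mul _ hJ3 (differentiableAt_of_contDiffOn hU (hf.contDiffOn hψ hψs) hy),
      partialDeriv_comp_snd (F := fun w : ℝ × E n => J w.2) hJ2, partialDeriv_comp_snd hJ']
  | congr f g hf hfg ih =>
    exact .congr _ _ ih fun y hy => partialDeriv_congr _ hU hfg hy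

end PullbackClass

end Pullback

/-- With `N = card ι` and `τ` the trace of `gs`, tracing the equation with `gm` gives `tr(γ⁻¹ R) +
(N - 1) τ + (N + 1) τ = 0`: the time direction adds no Ricci curvature but counts in `tr gm = N +
1`. -/
theorem trace_inv_mul_eq_neg_scalar {ι : Type*} [Fintype ι] [DecidableEq ι]
    {γ R : Matrix ι ι ℝ} {gs : Matrix (Option ι) (Option ι) ℝ} (hdet : γ.det ≠ 0)
    (hN : (Fintype.card ι : ℝ) ≠ 0)
    (h : ∀ a b, blockOption 0 R a b + ((Fintype.card ι : ℝ) - 1) * gs a b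
      + ((blockOption (-1) γ)⁻¹ * gs).trace * blockOption (-1) γ a b = 0) :
    ((blockOption (-1) γ)⁻¹ * gs).trace = -(γ⁻¹ * R).trace / (2 * Fintype.card ι) := by
  set gm := blockOption (-1) γ with hgm
  set τ := (gm⁻¹ * gs).trace with hτ
  have hm : blockOption 0 R + ((Fintype.card ι : ℝ) - 1) • gs + τ • gm = 0 := by
    ext a b
    simpa using h a b
  have hdet' : gm.det ≠ 0 := blockOption_det_ne_zero (by norm_num) hdet
  have ht := congrArg (fun M => (gm⁻¹ * M).trace) hm
  have hR : (gm⁻¹ * blockOption 0 R).trace = (γ⁻¹ * R).trace := by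
    rw [hgm, blockOption_inv (by norm_num) hdet]
    simp [Matrix.trace, Matrix.mul_apply, Fintype.sum_option]
  simp only [Matrix.mul_add, Matrix.mul_smul, Matrix.trace_add, Matrix.trace_smul, hR, ← hτ,
    Matrix.nonsing_inv_mul _ hdet'.isUnit, Matrix.trace_one, Matrix.mul_zero, Matrix.trace_zero,
    Fintype.card_option, smul_eq_mul] at ht
  push_cast at ht
  field_simp
  linarith

/-- A spectator variable, here the time, does not affect curvature computed in the other directions.
-/
theorem ricciCoord_comp_snd {V ι : Type*} [NormedAddCommGroup V] [NormedSpace ℝ V] [Fintype ι]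
    [DecidableEq ι] (e : ι → V) {B : V → Matrix ι ι ℝ} {U : Set V} (hU : IsOpen U)
    (hB : ∀ a b, ContDiffOn ℝ ∞ (fun z => B z a b) U) (hdet : ∀ z ∈ U, (B z).det ≠ 0)
    {y : ℝ × V} (hy : y.2 ∈ U) (i j : ι) :
    ricciCoord (fun a => ((0, e a) : ℝ × V)) (fun z => B z.2) i j y
      = ricciCoord e B i j y.2 := by
  have hU' : IsOpen (Set.univ ×ˢ U : Set (ℝ × V)) := isOpen_univ.prod hU
  have hy' : y ∈ (Set.univ ×ˢ U : Set (ℝ × V)) := ⟨trivial, hy⟩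
  have hc : ∀ k i j, ∀ z ∈ (Set.univ ×ˢ U : Set (ℝ × V)),
      christoffel (fun a => ((0, e a) : ℝ × V)) (fun z => B z.2) k i j z
        = christoffel e B k i j z.2 := by
    intro k i j z hz
    have hp : ∀ c a b, partialDeriv ((0, e c) : ℝ × V) (fun z : ℝ × V => B z.2 a b) z
        = partialDeriv (e c) (fun z => B z a b) z.2 := fun c a b =>
      partialDeriv_comp_snd (F := fun z => B z a b)
        (differentiableAt_of_contDiffOn hU (hB a b) hz.2) _
    simp only [christoffel, hp]
  have hd : ∀ c k i j, partialDeriv ((0, e c) : ℝ × V)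
      (christoffel (fun a => ((0, e a) : ℝ × V)) (fun z => B z.2) k i j) y
        = partialDeriv (e c) (christoffel e B k i j) y.2 := fun c k i j => by
    rw [partialDeriv_congr _ hU' (hc k i j) hy', partialDeriv_comp_snd
      (differentiableAt_of_contDiffOn hU (contDiffOn_christoffel e hU hB hdet k i j) hy)]
  simp only [ricciCoord, hd, hc _ _ _ y hy']

/-! ### Components of the boundary metric and of the remainder. -/

section Tensors

variable {n : ℕ} {S : Type*} [TopologicalSpace S] [ChartedSpace (E n) S]
  {φ : OpenPartialHomeomorph S (E n)}

theorem boundaryMetric_apply (γ : ℝ → TensorS n S) (t : ℝ) (x : S) (X Y : ℝ × TS n x) :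
    boundaryMetric γ t x X Y = γ t x X.2 Y.2 - X.1 * Y.1 := rfl

theorem compTensorI_boundaryMetric (γ : ℝ → TensorS n S) (y : Coords n) :
    compTensorI φ (boundaryMetric γ) y = blockOption (-1) (compTensorS φ (γ y.2.1) y.2.2) := by
  ext a b
  have h : compTensorI φ (boundaryMetric γ) y a b
      = boundaryMetric γ y.2.1 (φ.symm y.2.2) (frameI φ y.2.2 a) (frameI φ y.2.2 b) := rfl
  rw [h, boundaryMetric_apply]
  rcases a with _ | A <;> rcases b with _ | B <;> simp [frameI, compTensorS]

/-- A kernel vector of the Gram matrix gives a combination of frame vectors of zero length, which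
vanishes by positivity; the differential of the chart then recovers its zero coefficients. -/
theorem det_compTensorS_ne_zero [IsManifold 𝓘(ℝ, E n) ∞ S] (hφ : φ ∈ charts n S) {γ : TensorS n S}
    (hpos : ∀ x (v : TS n x), v ≠ 0 → 0 < γ x v v) {z : E n} (hz : z ∈ φ.target) :
    (compTensorS φ γ z).det ≠ 0 := by
  intro h0
  obtain ⟨v, hv0, hv⟩ := Matrix.exists_mulVec_eq_zero_iff.2 h0
  let B : LinearMap.BilinForm ℝ (E n) := γ (φ.symm z)
  let u : E n := ∑ A, v A • symmDeriv φ z (dirS n A)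
  have hB : B u u = ∑ A, v A * (Matrix.mulVec (compTensorS φ γ z) v) A := by
    have hc : ∀ A A', compTensorS φ γ z A A'
        = B (symmDeriv φ z (dirS n A)) (symmDeriv φ z (dirS n A')) := fun _ _ => rfl
    simp only [u, map_sum, LinearMap.sum_apply, map_smul, LinearMap.smul_apply, smul_eq_mul,
      Matrix.mulVec, dotProduct, hc, Finset.mul_sum]
    rw [Finset.sum_comm]
    refine Finset.sum_congr rfl fun A _ => Finset.sum_congr rfl fun A' _ => ?_
    ring
  have hu : u = 0 := by
    by_contra hne
    have h1 : 0 < B u u := hpos (φ.symm z) u hne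
    rw [hB, hv] at h1
    simp at h1
  have hcd := chartDeriv_comp_symmDeriv hφ (φ.map_target hz)
  rw [φ.right_inv hz] at hcd
  refine hv0 (funext fun A => ?_)
  have h2 : ∑ A, v A • dirS n A = 0 := by
    have h3 := congrArg (chartDeriv φ (φ.symm z)) hu
    simp only [u, map_sum, map_smul, map_zero] at h3
    have h4 : ∀ w, chartDeriv φ (φ.symm z) (symmDeriv φ z w) = w := fun w =>
      DFunLike.congr_fun hcd w
    simpa only [h4] using h3
  have h5 := sum_smul_dirS (n := n) (WithLp.toLp 2 v)
  rw [show ∑ A, (WithLp.toLp 2 v : E n) A • dirS n A = 0 from h2] at h5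
  have := congrArg (fun w : E n => w A) h5
  simpa using this.symm

theorem dirM_some (a : IdxI n) : dirM n (some a) = (0, extendDir (dirS n) a) := by
  cases a <;> rfl

theorem dirM_eq_extendDir : dirM n = extendDir (extendDir (dirS n)) := by
  funext α
  rcases α with _ | _ | A <;> rfl

/-- Components in `χ` are combinations, with Jacobian coefficients, of pulled-back components in
`φ`. Bounds known in a chart of `Ξ` thus become available in an arbitrary chart. -/
theorem pullbackClass_compHTensorM {ρs T : ℝ} {χ : OpenPartialHomeomorph S (E n)}
    (hφ : φ ∈ charts n S) (hχ : χ ∈ charts n S) {h : HTensorM n S}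
    (hh : ∀ a b, IsBigOOne ρs T φ fun y => compHTensorM φ h y a b) (a b : IdxI n) :
    PullbackClass ρs T φ (transition χ φ) (transitionDomain χ φ) 0
      fun y => compHTensorM χ h y a b :=
  .congr _ _ (PullbackClass.sum Finset.univ fun c _ => PullbackClass.sum Finset.univ fun d _ =>
    .mul _ (contDiffOn_transitionJacobian hφ hχ a c) _
      (.mul _ (contDiffOn_transitionJacobian hφ hχ b d) _ (.base _ (hh c d) [])))
    fun _ hy => compHTensorM_transition hφ hχ h hy.2.2 a b

end Tensors

/-! ### The boundary equation of a vacuum segment. -/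

namespace Segment

variable {n : ℕ} {S : Type*} [TopologicalSpace S] [ChartedSpace (E n) S] {T : ℝ}
  (𝓜 : Segment n S T)

/-- The components of `gm + ρ² gs + ρ³ r`. -/
def sliceMetric (φ : OpenPartialHomeomorph S (E n)) (y : Coords n) : Matrix (IdxI n) (IdxI n) ℝ :=
  Matrix.of fun a b => compTensorI φ (boundaryMetric 𝓜.γ) (0, y.2) a b
    + y.1 ^ 2 * compTensorI φ 𝓜.gs (0, y.2) a b + y.1 ^ 3 * compHTensorM φ 𝓜.r y a b

theorem compTensorM_g (φ : OpenPartialHomeomorph S (E n)) {y : Coords n}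
    (hy : y ∈ coordDomain 𝓜.ρs T φ) :
    compTensorM φ 𝓜.g y = blockOption (y.1 ^ 2)⁻¹ ((y.1 ^ 2)⁻¹ • 𝓜.sliceMetric φ y) := by
  ext α β
  have h : compTensorM φ 𝓜.g y α β
      = 𝓜.g y.1 y.2.1 (φ.symm y.2.2) (frameM φ y.2.2 α) (frameM φ y.2.2 β) := rfl
  rw [h, 𝓜.expansion y.1 hy.1 y.2.1 hy.2.1]
  have h0 : (frameM φ y.2.2 none).2 = 0 := rfl
  rcases α with _ | a <;> rcases β with _ | b
  · simp only [h0, map_zero]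
    simp [frameM]
  · simp only [h0, map_zero]
    simp [frameM]
  · simp only [h0, map_zero]
    simp [frameM]
  · simp only [frameM, blockOption_some_some, mul_zero, zero_add]
    rfl

/-- The `ρ` coordinate is a dummy for tensors on `I`: the value at `ρ = 0`, outside the domain,
equals the value at `ρs / 2`, where smoothness is known. -/
theorem contDiffOn_compTensorI_slice {h : TensorI n S} {φ : OpenPartialHomeomorph S (E n)}
    {a b : IdxI n} (hh : ContDiffOn ℝ ∞ (fun y => compTensorI φ h y a b) (coordDomain 𝓜.ρs T φ)) :
    ContDiffOn ℝ ∞ (fun w : ℝ × E n => compTensorI φ h (0, w) a b)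
      (Set.Ioo 0 (Real.pi * T) ×ˢ φ.target) := by
  have h1 : ContDiffOn ℝ ∞ (fun w : ℝ × E n => ((𝓜.ρs / 2, w) : Coords n))
      (Set.Ioo 0 (Real.pi * T) ×ˢ φ.target) :=
    (contDiff_const.prodMk contDiff_id).contDiffOn
  have h2 : Set.MapsTo (fun w : ℝ × E n => ((𝓜.ρs / 2, w) : Coords n))
      (Set.Ioo 0 (Real.pi * T) ×ˢ φ.target) (coordDomain 𝓜.ρs T φ) :=
    fun w hw => ⟨⟨half_pos 𝓜.ρs_pos, half_lt_self 𝓜.ρs_pos⟩, hw⟩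
  have h3 := ContDiffOn.comp hh h1 h2
  exact h3

variable [IsManifold 𝓘(ℝ, E n) ∞ S]

/-- The Einstein equations in the preferred coordinates at a point. -/
theorem ricciCoord_of_einsteinVacuum (hE : 𝓜.EinsteinVacuum) {ρ t : ℝ}
    (hρ : ρ ∈ Set.Ioo 0 𝓜.ρs) (ht : t ∈ Set.Ioo 0 (Real.pi * T)) (x : S) (a b : IdxI n) :
    ricciCoord (dirM n) (compTensorM (chartAt (E n) x) 𝓜.g) (some a) (some b)
        (ρ, t, chartAt (E n) x x)
      = -(n : ℝ) * ((ρ ^ 2)⁻¹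
        * 𝓜.sliceMetric (chartAt (E n) x) (ρ, t, chartAt (E n) x x) a b) := by
  set χ := chartAt (E n) x with hχd
  have hχ : χ ∈ charts n S := IsManifold.chart_mem_maximalAtlas x
  have hx : x ∈ χ.source := mem_chart_source _ x
  -- On frame vectors the components are Kronecker deltas, so the double sum defining the Ricci
  -- tensor collapses to one entry.
  have h := hE ρ hρ t ht x (0, frameAt χ x a) (0, frameAt χ x b)
  rw [𝓜.expansion ρ hρ t ht] at h
  have hc : ∀ a b, compM χ x (0, frameAt χ x a) (some b)
      = (1 : Matrix (IdxI n) (IdxI n) ℝ) a b := fun a b => compI_frameAt hχ hx a b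
  have hc0 : ∀ a, compM χ x (0, frameAt χ x a) none = 0 := fun _ => rfl
  have hl : ricciM 𝓜.g ρ t x (0, frameAt χ x a) (0, frameAt χ x b)
      = ricciCoord (dirM n) (compTensorM χ 𝓜.g) (some a) (some b) (ρ, t, χ x) := by
    unfold ricciM
    simp only [← hχd]
    rw [Fintype.sum_option, Finset.sum_congr rfl fun a _ => Fintype.sum_option _]
    simp [hc, hc0, Matrix.one_apply]
  rw [hl] at h
  rw [h]
  have e1 := compHTensorM_eq_frameAt hx (fun _ => boundaryMetric 𝓜.γ) 0 t a b
  have e2 := compHTensorM_eq_frameAt hx (fun _ => 𝓜.gs) 0 t a b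
  have e3 := compHTensorM_eq_frameAt hx 𝓜.r ρ t a b
  simp only [sliceMetric, Matrix.of_apply, compTensorI]
  rw [← e1, ← e2, ← e3]
  simp only [mul_zero, zero_add]

variable {𝓜} in
-- The limiting Einstein equation in the preferred chart at `x`. That chart need not belong to `Ξ`,
-- so the decay of the remainder is imported from a chart of `Ξ` around `x`.
theorem boundary_equation (hn : 1 ≤ n) (hE : 𝓜.EinsteinVacuum) {t : ℝ}
    (ht : t ∈ Set.Ioo 0 (Real.pi * T)) (x : S) (a b : IdxI n) :
    let χ := chartAt (E n) x
    let gm := fun w : ℝ × E n => compTensorI χ (boundaryMetric 𝓜.γ) (0, w)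
    let gs := compTensorI χ 𝓜.gs (0, t, χ x)
    ricciCoord (extendDir (dirS n)) gm a b (t, χ x) + ((n : ℝ) - 2) * gs a b
      + ((gm (t, χ x))⁻¹ * gs).trace * gm (t, χ x) a b = 0 := by
  intro χ gm gs
  have hχ : χ ∈ charts n S := IsManifold.chart_mem_maximalAtlas x
  have hx : x ∈ χ.source := mem_chart_source _ x
  obtain ⟨φ, hφΞ, hxφ⟩ := 𝓜.Ξ_covers x
  have hφ : φ ∈ charts n S := 𝓜.Ξ_charts hφΞ
  have hcard : (Fintype.card (IdxI n) : ℝ) = n := by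
    rw [Fintype.card_option, Fintype.card_fin, Nat.sub_add_cancel hn]
  have hz : χ x ∈ transitionDomain χ φ := ⟨χ.map_source hx, by
    rw [Set.mem_preimage, χ.left_inv hx]
    exact hxφ⟩
  -- The source of all five remainder bounds below: on `r`, on its first and second tangential
  -- derivatives, and on its first and second `ρ`-derivatives.
  have hpc := pullbackClass_compHTensorM hφ hχ (𝓜.r_bounded φ hφΞ)
  have hΩ := isOpen_transitionDomain χ φ
  have hm := mapsTo_transition (χ := χ) (φ := φ)
  have hs := contDiffOn_transition hφ hχ
  have key := ricciCoord_boundary_of_einstein (extendDir (dirS n)) 𝓜.ρs_pos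
    (Ω := Set.Ioo 0 (Real.pi * T) ×ˢ χ.target) (w := (t, χ x)) (isOpen_Ioo.prod χ.open_target)
    ⟨ht, χ.map_source hx⟩ (gm := gm) (gs := fun w => compTensorI χ 𝓜.gs (0, w))
    (r := compHTensorM χ 𝓜.r)
    (fun a b => 𝓜.contDiffOn_compTensorI_slice (𝓜.gm_smooth χ hχ a b))
    (fun a b => 𝓜.contDiffOn_compTensorI_slice (𝓜.gs_smooth χ hχ a b))
    (fun a b => 𝓜.r_smooth χ hχ a b)
    (fun z hz a b => by
      change boundaryMetric 𝓜.γ z.1 _ _ _ = boundaryMetric 𝓜.γ z.1 _ _ _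
      rw [boundaryMetric_apply, boundaryMetric_apply, 𝓜.γ_symm _ hz.1, mul_comm])
    (fun z hz a b => 𝓜.gs_symm _ hz.1 _ _ _)
    (fun z hz a b => 𝓜.r_symm _ hz.1 _ hz.2.1 _ _ _)
    (by
      simp only [gm, compTensorI_boundaryMetric]
      exact blockOption_det_ne_zero (by norm_num)
        (det_compTensorS_ne_zero hχ (𝓜.γ_pos t ht) (χ.map_source hx)))
    (fun a b => by simpa using (hpc a b).bound hm ht hz)
    (fun c a b => by
      rw [← dirM_some]
      simpa using ((hpc a b).partialDeriv_dirM_some hΩ hm hs c).bound hm ht hz)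
    (fun d c a b => by
      rw [← dirM_some, ← dirM_some]
      simpa using (((hpc a b).partialDeriv_dirM_some hΩ hm hs c).partialDeriv_dirM_some
        hΩ hm hs d).bound hm ht hz)
    (fun a b => ((hpc a b).partialDeriv_dirM_none hΩ hm hs).bound hm ht hz)
    (fun a b => (((hpc a b).partialDeriv_dirM_none hΩ hm hs).partialDeriv_dirM_none
      hΩ hm hs).bound hm ht hz)
    (H := 𝓜.sliceMetric χ) (fun z a b => rfl) a b
    (fun ρ hρ => by
      rw [hcard, ← 𝓜.ricciCoord_of_einsteinVacuum hE hρ ht x a b, dirM_eq_extendDir]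
      exact (ricciCoord_congr _ (PullbackClass.isOpen_coordDomain 𝓜.ρs T χ)
        (fun y hy => 𝓜.compTensorM_g χ hy) _ _ ⟨hρ, ht, χ.map_source hx⟩).symm)
  rw [hcard] at key
  exact key

end Segment

/-! ### Admissible choices of `ζ` and `μ`. -/

section BigO

variable {n : ℕ} {S : Type*} [TopologicalSpace S]

theorem iterPartial_add_const {V : Type*} [NormedAddCommGroup V] [NormedSpace ℝ V]
    (l : List V) (F : V → ℝ) (c : ℝ) :
    iterPartial l (fun y => F y + c)
      = fun y => iterPartial l F y + if l = [] then c else 0 := by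
  induction l with
  | nil => simp [iterPartial]
  | cons v l ih =>
    funext y
    simp [iterPartial, ih, partialDeriv, fderiv_add_const]

/-- Needed because the function `ζ` used below is a component of `gs` plus a constant. -/
theorem IsBigOOne.add_const {ρs T : ℝ} {φ : OpenPartialHomeomorph S (E n)} {u : Coords n → ℝ}
    (hu : IsBigOOne ρs T φ u) (c : ℝ) : IsBigOOne ρs T φ fun y => u y + c := by
  refine ⟨hu.1.add contDiffOn_const, fun k l => ?_⟩
  obtain ⟨K, hK⟩ := hu.2 k l
  refine ⟨K + |c|, fun y hy => ?_⟩
  have hk : (0 : ℝ) ≤ (y.1 ^ k)⁻¹ := inv_nonneg.2 (pow_nonneg hy.1.1.le k)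
  rw [iterPartial_add_const, add_mul]
  refine (abs_add_le _ _).trans (add_le_add (hK y hy) ?_)
  split_ifs with h
  · have h0 : k = 0 := by simpa using (List.append_eq_nil_iff.1 h).1
    simp [h0]
  · rw [abs_zero]
    exact mul_nonneg (abs_nonneg c) hk

end BigO

/-- With `ξ = 0` the arctangent counts as `π / 2`, and the relation reads `T = 2 T - T`. -/
theorem isMu_zero {T : ℝ} (hT : 0 < T) : IsMu T 0 (1 / T) := by
  refine ⟨le_rfl, div_lt_div_of_pos_right (by norm_num) hT, ?_⟩
  have := Real.pi_pos.ne'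
  rw [if_pos rfl]
  field_simp
  norm_num

/-! ### Static boundaries: the Schouten tensor and the two criteria. -/

namespace Segment

variable {n : ℕ} {S : Type*} [TopologicalSpace S] [ChartedSpace (E n) S] {T : ℝ}
  {𝓜 : Segment n S T} {γ : TensorS n S}

/-- A sample time at which properties of the time-dependent metric pass to the static one. -/
theorem exists_time (𝓜 : Segment n S T) : Real.pi * T / 2 ∈ Set.Ioo 0 (Real.pi * T) := by
  have := mul_pos Real.pi_pos 𝓜.T_pos
  constructor <;> linarith

theorem IsStatic.pos (hγ : 𝓜.IsStatic γ) (x : S) (v : TS n x) (hv : v ≠ 0) : 0 < γ x v v := by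
  rw [← hγ _ 𝓜.exists_time x]
  exact 𝓜.γ_pos _ 𝓜.exists_time x v hv

theorem IsStatic.symm (hγ : 𝓜.IsStatic γ) (x : S) (v w : TS n x) : γ x v w = γ x w v := by
  rw [← hγ _ 𝓜.exists_time x]
  exact 𝓜.γ_symm _ 𝓜.exists_time x v w

theorem IsStatic.gm_apply (hγ : 𝓜.IsStatic γ) {t : ℝ} (ht : t ∈ Set.Ioo 0 (Real.pi * T)) (x : S)
    (X : ℝ × TS n x) : 𝓜.gm t x X X = γ x X.2 X.2 - X.1 ^ 2 := by
  rw [← hγ t ht x, sq]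
  rfl

theorem IsStatic.compTensorS_eq (hγ : 𝓜.IsStatic γ) {t : ℝ} (ht : t ∈ Set.Ioo 0 (Real.pi * T))
    (φ : OpenPartialHomeomorph S (E n)) (z : E n) :
    compTensorS φ (𝓜.γ t) z = compTensorS φ γ z := by
  ext A B
  simp only [compTensorS, Matrix.of_apply, hγ t ht]

theorem IsStatic.contDiffOn_compTensorS (hγ : 𝓜.IsStatic γ) {φ : OpenPartialHomeomorph S (E n)}
    (hφ : φ ∈ charts n S) (A B : Fin (n - 1)) :
    ContDiffOn ℝ ∞ (fun z => compTensorS φ γ z A B) φ.target := by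
  have h := 𝓜.contDiffOn_compTensorI_slice (𝓜.gm_smooth φ hφ (some A) (some B))
  have h1 : ContDiffOn ℝ ∞ (fun z : E n => (Real.pi * T / 2, z)) φ.target :=
    (contDiff_const.prodMk contDiff_id).contDiffOn
  refine (h.comp h1 fun z hz => ⟨𝓜.exists_time, hz⟩).congr fun z _ => ?_
  simp [compTensorI_boundaryMetric, hγ.compTensorS_eq 𝓜.exists_time]

variable [IsManifold 𝓘(ℝ, E n) ∞ S]

/-- The Ricci curvature of a static boundary metric. -/
theorem IsStatic.ricciCoord_boundaryMetric (hγ : 𝓜.IsStatic γ) {t : ℝ}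
    (ht : t ∈ Set.Ioo 0 (Real.pi * T)) {φ : OpenPartialHomeomorph S (E n)} (hφ : φ ∈ charts n S)
    {z : E n} (hz : z ∈ φ.target) :
    (∀ b, ricciCoord (extendDir (dirS n))
      (fun w => compTensorI φ (boundaryMetric 𝓜.γ) (0, w)) none b (t, z) = 0) ∧
    ∀ A B, ricciCoord (extendDir (dirS n))
      (fun w => compTensorI φ (boundaryMetric 𝓜.γ) (0, w)) (some A) (some B) (t, z)
        = ricciCoord (dirS n) (compTensorS φ γ) A B z := by
  have hU : IsOpen (Set.Ioo 0 (Real.pi * T) ×ˢ φ.target) := isOpen_Ioo.prod φ.open_target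
  have hy : (t, z) ∈ Set.Ioo 0 (Real.pi * T) ×ˢ φ.target := ⟨ht, hz⟩
  have heq : Set.EqOn (fun w => compTensorI φ (boundaryMetric 𝓜.γ) (0, w))
      (fun w => blockOption (-1) (compTensorS φ γ w.2)) (Set.Ioo 0 (Real.pi * T) ×ˢ φ.target) :=
    fun w hw => by simp only [compTensorI_boundaryMetric, hγ.compTensorS_eq hw.1]
  have hdet : ∀ w ∈ φ.target, (compTensorS φ γ w).det ≠ 0 := fun w hw =>
    det_compTensorS_ne_zero hφ hγ.pos hw
  have hB : ∀ w ∈ Set.Ioo 0 (Real.pi * T) ×ˢ φ.target, ∀ A B,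
      partialDeriv (extendDir (dirS n) none) (fun w : ℝ × E n => compTensorS φ γ w.2 A B) w
        = 0 := by
    intro w hw A B
    rw [partialDeriv_comp_snd (F := fun z => compTensorS φ γ z A B)
      (differentiableAt_of_contDiffOn φ.open_target (hγ.contDiffOn_compTensorS hφ A B) hw.2)]
    simp [extendDir, partialDeriv]
  refine ⟨fun b => ?_, fun A B => ?_⟩
  · rw [ricciCoord_congr _ hU heq _ _ hy]
    exact ricciCoord_block_none (extendDir (dirS n)) (α := fun _ => -1)
      (B := fun w => compTensorS φ γ w.2) hU (fun _ _ => by norm_num) (fun w hw => hdet w.2 hw.2)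
      (fun _ _ _ => partialDeriv_const _ _) hB hy b
  · rw [ricciCoord_congr _ hU heq _ _ hy, ricciCoord_block_some_some_of_static
      (extendDir (dirS n)) (α := fun _ => -1) (B := fun w => compTensorS φ γ w.2) hU
      (fun _ _ => by norm_num) (fun w hw => hdet w.2 hw.2) (fun _ _ _ => partialDeriv_const _ _)
      hB hy A B]
    exact ricciCoord_comp_snd (dirS n) φ.open_target (hγ.contDiffOn_compTensorS hφ) hdet
      (y := (t, z)) hz A B

/-- For a static boundary, the second coefficient of the expansion of a vacuum metric is minus
the Schouten tensor of the boundary metric. -/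
theorem IsStatic.gs_apply (hγ : 𝓜.IsStatic γ) (hn : 3 ≤ n) (hE : 𝓜.EinsteinVacuum) {t : ℝ}
    (ht : t ∈ Set.Ioo 0 (Real.pi * T)) (x : S) (X : ℝ × TS n x) :
    𝓜.gs t x X X = -(ricciS γ x X.2 X.2) / ((n : ℝ) - 2)
      + scalarS γ x / (2 * ((n : ℝ) - 1) * ((n : ℝ) - 2)) * 𝓜.gm t x X X := by
  have hn' : (3 : ℝ) ≤ n := by exact_mod_cast hn
  set χ := chartAt (E n) x with hχd
  have hχ : χ ∈ charts n S := IsManifold.chart_mem_maximalAtlas x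
  have hx : x ∈ χ.source := mem_chart_source _ x
  set γc := compTensorS χ γ (χ x) with hγc
  set R : Matrix (Fin (n - 1)) (Fin (n - 1)) ℝ :=
    Matrix.of fun A B => ricciCoord (dirS n) (compTensorS χ γ) A B (χ x) with hR
  set gsc := compTensorI χ 𝓜.gs (0, t, χ x) with hgsc
  have hcard : (Fintype.card (Fin (n - 1)) : ℝ) = n - 1 := by
    rw [Fintype.card_fin, Nat.cast_sub (by omega), Nat.cast_one]
  have hgm : compTensorI χ (boundaryMetric 𝓜.γ) (0, t, χ x) = blockOption (-1) γc := by
    rw [compTensorI_boundaryMetric, hγ.compTensorS_eq ht]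
  obtain ⟨hr0, hr1⟩ := hγ.ricciCoord_boundaryMetric ht hχ (χ.map_source hx)
  have hgs_symm : ∀ a b, gsc a b = gsc b a := fun a b => 𝓜.gs_symm t ht _ _ _
  have hbe := fun a b => boundary_equation (by omega) hE ht x a b
  simp only [← hχd, ← hgsc, hgm] at hbe
  -- The vanishing of Ricci is known for first index `t`; the entries with only the second index
  -- equal to `t` follow from the symmetry of `gs`.
  have heq : ∀ a b, blockOption 0 R a b + ((n : ℝ) - 2) * gsc a b
      + ((blockOption (-1) γc)⁻¹ * gsc).trace * blockOption (-1) γc a b = 0 := by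
    intro a b
    rcases a with _ | A
    · have := hbe none b
      rw [hr0] at this
      rcases b with _ | B <;> exact this
    · rcases b with _ | B
      · have := hbe none (some A)
        rw [hr0, hgs_symm] at this
        exact this
      · have := hbe (some A) (some B)
        rw [hr1] at this
        exact this
  have hdet : γc.det ≠ 0 := det_compTensorS_ne_zero hχ hγ.pos (χ.map_source hx)
  have hτ := trace_inv_mul_eq_neg_scalar hdet (by rw [hcard]; linarith) (fun a b => by
    rw [hcard, sub_sub, one_add_one_eq_two]
    exact heq a b)
  have hγt : γc.transpose = γc := by
    ext A B
    exact hγ.symm _ _ _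
  have hscal : (γc⁻¹ * R).trace = scalarS γ x := by
    have hγi : ∀ A B, γc⁻¹ A B = γc⁻¹ B A := fun A B => by
      rw [← Matrix.transpose_apply γc⁻¹ B A, Matrix.transpose_nonsing_inv, hγt]
    simp only [Matrix.trace, Matrix.diag, Matrix.mul_apply, hR, Matrix.of_apply]
    rw [Finset.sum_comm]
    refine Finset.sum_congr rfl fun A _ => Finset.sum_congr rfl fun B _ => ?_
    rw [hγi]
  rw [hscal, hcard] at hτ
  rw [hτ] at heq
  -- Solving for `gs` divides by `n - 2`, which is nonzero since `n ≥ 3`.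
  have hcomp : ∀ a b, gsc a b = -(blockOption 0 R a b) / ((n : ℝ) - 2)
      + scalarS γ x / (2 * ((n : ℝ) - 1) * ((n : ℝ) - 2)) * blockOption (-1) γc a b := by
    intro a b
    have h1 : (n : ℝ) - 1 ≠ 0 := by linarith
    have h2 : (n : ℝ) - 2 ≠ 0 := by linarith
    have h := heq a b
    field_simp at h ⊢
    linarith
  have hgsX := bilin_eq_sum_compI hχ hx (𝓜.gs t x) X X
  have hgmX := bilin_eq_sum_compI hχ hx (𝓜.gm t x) X X
  have hgsc' : ∀ a b, 𝓜.gs t x (frameAt χ x a) (frameAt χ x b) = gsc a b := fun a b =>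
    (compHTensorM_eq_frameAt hx (fun _ => 𝓜.gs) 0 t a b).symm
  have hgmc' : ∀ a b, 𝓜.gm t x (frameAt χ x a) (frameAt χ x b) = blockOption (-1) γc a b := by
    intro a b
    rw [← hgm]
    exact (compHTensorM_eq_frameAt hx (fun _ => boundaryMetric 𝓜.γ) 0 t a b).symm
  have hricX : ricciS γ x X.2 X.2
      = ∑ a, ∑ b, blockOption 0 R a b * compI χ x X a * compI χ x X b := by
    rw [Fintype.sum_option, Finset.sum_congr rfl fun a _ => Fintype.sum_option _]
    simp [Fintype.sum_option]
    rfl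
  rw [hgsX, hgmX, hricX]
  simp only [hgsc', hgmc', hcomp, neg_div, Finset.sum_div, Finset.mul_sum,
    ← Finset.sum_neg_distrib, ← Finset.sum_add_distrib]
  refine Finset.sum_congr rfl fun a _ => Finset.sum_congr rfl fun b _ => ?_
  ring

/-- The Ricci tensor has no `dt` part, so `gs(∂_t, ∂_t)` is the normalised scalar curvature up to
sign. Smoothness and bounds for the latter are thus inherited from those of `gs`, with no estimate
of curvature. -/
theorem IsStatic.gs_time (hγ : 𝓜.IsStatic γ) (hn : 3 ≤ n) (hE : 𝓜.EinsteinVacuum) {t : ℝ}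
    (ht : t ∈ Set.Ioo 0 (Real.pi * T)) (x : S) :
    𝓜.gs t x (1, 0) (1, 0) = -(scalarS γ x / (2 * ((n : ℝ) - 1) * ((n : ℝ) - 2))) := by
  rw [hγ.gs_apply hn hE ht, hγ.gm_apply ht]
  have h0 : ∀ A, compS (chartAt (E n) x) x (0 : TS n x) A = 0 := fun A => by
    unfold compS
    rw [map_zero]
    exact map_zero (EuclideanSpace.proj (𝕜 := ℝ) A)
  simp [ricciS, h0]

/-- The uniform positivity of the tensor `-gs - c² dt² + [⋯] gm`. -/
theorem IsStatic.lower_bound (hγ : 𝓜.IsStatic γ) (hn : 3 ≤ n) (hE : 𝓜.EinsteinVacuum) {C : ℝ}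
    (hric : ∀ (x : S) (v : TS n x), ((n : ℝ) - 2) * C ^ 2 * γ x v v ≤ ricciS γ x v v) (c : ℝ)
    {t : ℝ} (ht : t ∈ Set.Ioo 0 (Real.pi * T)) (x : S) (X : ℝ × TS n x) :
    (C ^ 2 - c ^ 2) / 2 * (X.1 ^ 2 + γ x X.2 X.2) ≤ -𝓜.gs t x X X - c ^ 2 * X.1 ^ 2
      + (scalarS γ x / (2 * ((n : ℝ) - 1) * ((n : ℝ) - 2)) - (C ^ 2 + c ^ 2) / 2)
        * 𝓜.gm t x X X := by
  have hn' : (0 : ℝ) < n - 2 := by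
    have : (3 : ℝ) ≤ n := by exact_mod_cast hn
    linarith
  have h : C ^ 2 * γ x X.2 X.2 ≤ ricciS γ x X.2 X.2 / ((n : ℝ) - 2) := by
    rw [le_div_iff₀ hn']
    linarith [hric x X.2]
  -- The scalar curvature cancels. The time coefficient becomes `-c² + ½ (C² + c²)` and the spatial
  -- one is at least `C² - ½ (C² + c²)`; both equal `½ (C² - c²)`.
  rw [hγ.gs_apply hn hE ht, hγ.gm_apply ht, neg_div]
  linarith

theorem IsStatic.pseudoconvexityProperty (hγ : 𝓜.IsStatic γ) (hn : 3 ≤ n)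
    (hE : 𝓜.EinsteinVacuum) {C : ℝ} (hC : 0 < C)
    (hric : ∀ (x : S) (v : TS n x), ((n : ℝ) - 2) * C ^ 2 * γ x v v ≤ ricciS γ x v v)
    (hT : 1 / C < T) : 𝓜.PseudoconvexityProperty := by
  have hc : 1 / T < C := by
    rw [div_lt_iff₀ hC] at hT
    rw [div_lt_iff₀ 𝓜.T_pos]
    linarith
  have hc0 : 0 < 1 / T := one_div_pos.2 𝓜.T_pos
  have hin : ∀ φ : OpenPartialHomeomorph S (E n),
      inCoords φ (fun _ t x => 𝓜.gs t x (1, 0) (1, 0) + (C ^ 2 + (1 / T) ^ 2) / 2)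
        = fun y => compTensorI φ 𝓜.gs y none none + (C ^ 2 + (1 / T) ^ 2) / 2 := fun _ => rfl
  -- The lower bound is used with `c = μ = 1 / T`, which dictates `ζ = -s + ½ (C² + c²)`; `-s` is
  -- written as `gs(∂_t, ∂_t)` so that `ζ` is visibly `O_φ(1)`.
  refine ⟨(C ^ 2 - (1 / T) ^ 2) / 2, ?_, 0, le_rfl, 1 / T, isMu_zero 𝓜.T_pos,
    fun _ t x => 𝓜.gs t x (1, 0) (1, 0) + (C ^ 2 + (1 / T) ^ 2) / 2, fun φ hφ => ?_,
    fun φ hφ => ?_, fun t ht x v => ?_, fun ρ _ t ht x X => ?_⟩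
  · have := pow_lt_pow_left₀ hc hc0.le two_ne_zero
    linarith
  · rw [hin]
    exact (𝓜.gs_smooth φ hφ none none).add contDiffOn_const
  · rw [hin]
    exact (𝓜.gs_bounded φ hφ none none).add_const _
  · have heq : (fun s => 𝓜.gm s x (0, v) (0, v)) =ᶠ[nhds t] fun _ => γ x v v := by
      filter_upwards [isOpen_Ioo.mem_nhds ht] with s hs
      rw [hγ.gm_apply hs]
      simp
    rw [heq.deriv_eq]
    simp
  · refine (le_of_eq ?_).trans ((hγ.lower_bound hn hE hric (1 / T) ht x X).trans (le_of_eq ?_))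
    · rw [hγ t ht]
    · simp only [quadForm, hγ.gs_time hn hE ht]
      ring

/-- At a point with `Ric ≤ 0`, the vector `∂_t` forces `s + ζ ≥ K` while any nonzero spatial vector
forces `s + ζ ≤ -K`. One value of `ρ` and `t` suffices, whatever `ξ` and `μ` are. -/
theorem IsStatic.not_pseudoconvexityProperty (hγ : 𝓜.IsStatic γ) (hn : 3 ≤ n)
    (hE : 𝓜.EinsteinVacuum) {x : S} (hx : ∀ v : TS n x, ricciS γ x v v ≤ 0) :
    ¬ 𝓜.PseudoconvexityProperty := by
  rintro ⟨K, hK, ξ, -, μ, -, ζ, -, -, -, h⟩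
  have hn' : (0 : ℝ) < n - 2 := by
    have : (3 : ℝ) ≤ n := by exact_mod_cast hn
    linarith
  have ht := 𝓜.exists_time
  have hρ : 𝓜.ρs / 2 ∈ Set.Ioo 0 𝓜.ρs := ⟨half_pos 𝓜.ρs_pos, half_lt_self 𝓜.ρs_pos⟩
  let v : TS n x := dirS n ⟨0, by omega⟩
  have hv : v ≠ 0 := by
    intro h0
    have : (dirS n ⟨0, by omega⟩) ⟨0, by omega⟩ = (0 : E n) ⟨0, by omega⟩ :=
      congrArg (fun w : E n => w ⟨0, by omega⟩) h0
    simp [dirS] at this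
  have hpos := hγ.pos x v hv
  have h1 := h _ hρ _ ht x (1, 0)
  have h2 := h _ hρ _ ht x (0, v)
  rw [quadForm, hγ.gs_time hn hE ht, hγ.gm_apply ht] at h1
  rw [quadForm, hγ.gs_apply hn hE ht, hγ.gm_apply ht, hγ _ ht] at h2
  set s := scalarS γ x / (2 * ((n : ℝ) - 1) * ((n : ℝ) - 2))
  have h3 : ricciS γ x v v / ((n : ℝ) - 2) ≤ 0 := div_nonpos_of_nonpos_of_nonneg (hx v) hn'.le
  simp only [map_zero, neg_div] at h1 h2
  -- The term `μ² + ξ² / 16` only lowers the form on `∂_t`, so it can be discarded.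
  have h4 : K ≤ s + ζ (𝓜.ρs / 2) (Real.pi * T / 2) x := by
    nlinarith [sq_nonneg μ, sq_nonneg ξ]
  have h5 : K * γ x v v ≤ -(s + ζ (𝓜.ρs / 2) (Real.pi * T / 2) x) * γ x v v := by
    linarith
  have h6 := le_of_mul_le_mul_right h5 hpos
  linarith

end Segment

end FGaAdS

end

open FGaAdS in
theorem propositionB2 {n : ℕ} (hn : 3 ≤ n) {S : Type*} [TopologicalSpace S]
    [ChartedSpace (E n) S] [IsManifold 𝓘(ℝ, E n) ∞ S] {T : ℝ}
    (𝓜 : Segment n S T) (hE : 𝓜.EinsteinVacuum) (γ : TensorS n S) (hγ : 𝓜.IsStatic γ) :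
    (∀ C : ℝ, 0 < C →
      (∀ (x : S) (v : TS n x), ((n : ℝ) - 2) * C ^ 2 * γ x v v ≤ ricciS γ x v v) →
      (∀ c : ℝ, 0 < c → c < C → ∃ K > 0, ∀ t ∈ Set.Ioo 0 (Real.pi * T), ∀ (x : S)
        (X : ℝ × TS n x), K * (X.1 ^ 2 + γ x X.2 X.2) ≤
          -𝓜.gs t x X X - c ^ 2 * X.1 ^ 2
            + (scalarS γ x / (2 * ((n : ℝ) - 1) * ((n : ℝ) - 2)) - (C ^ 2 + c ^ 2) / 2)
              * 𝓜.gm t x X X) ∧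
      (1 / C < T → 𝓜.PseudoconvexityProperty)) ∧
    ((∃ x : S, ∀ v : TS n x, ricciS γ x v v ≤ 0) → ¬ 𝓜.PseudoconvexityProperty) := by
  refine ⟨fun C hC hric => ⟨fun c hc hcC => ⟨(C ^ 2 - c ^ 2) / 2, ?_, fun t ht x X =>
    hγ.lower_bound hn hE hric c ht x X⟩, hγ.pseudoconvexityProperty hn hE hC hric⟩,
    fun ⟨_, hx⟩ => hγ.not_pseudoconvexityProperty hn hE hx⟩
  have := pow_lt_pow_left₀ hcC hc.le two_ne_zero
  linarith
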